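/- **Intuitionistic linear dependent type theory (ILDTT).** The raw types are $$A,B ::= \Sigma_{!x:!A}B \mid \Pi_{!x:!A}B \mid \mathrm{Id}_{!A}(a,a') \mid I \mid A\otimes B \mid A\multimap B \mid \top \mid A\,\&\,B \mid 0 \mid A\oplus B \mid {!A}$$ and the raw terms (up to $\alpha$-equivalence) are variables, $!a\otimes b$, $\mathrm{let}\ t\ \mathrm{be}\ {!x}\otimes y\ \mathrm{in}\ c$, $\lambda_{!x:!A}b$, $f(!a)$, $\mathrm{refl}_{!a}$, $\mathrm{let}\ (a,a',p)\ \mathrm{be}\ (z,z,\mathrm{refl}_{!z})\ \mathrm{in}\ d$, $*$, $\mathrm{let}\ t\ \mathrm{be}\ *\ \mathrm{in}\ a$, $a\otimes b$, $\mathrm{let}\ t\ \mathrm{be}\ x\otimes y\ \mathrm{in}\ c$, $\lambda_{x:A}b$, $f(a)$, $\langle\rangle$, $\langle a,b\rangle$, $\mathrm{fst}(t)$, $\mathrm{snd}(t)$, $\mathrm{false}(t)$, $\mathrm{inl}(a)$, $\mathrm{inr}(b)$, $\mathrm{case}\ t\ \mathrm{of}\ \mathrm{inl}(x)\to c\,\|\,\mathrm{inr}(y)\to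 d$, $!a$, $\mathrm{let}\ t\ \mathrm{be}\ {!x}\ \mathrm{in}\ b$. A context $\Delta;\Xi$ consists of an intuitionistic region $\Delta$ and a linear region $\Xi$; types depend on variables of $\Delta$ only. The judgements are $\vdash\Delta;\Xi\ \mathrm{ctxt}$, $\Delta;\cdot\vdash A\ \mathrm{type}$, $\Delta;\Xi\vdash a:A$ and the corresponding judgemental equalities of contexts, types and terms. They are generated inductively by the following rules, where an equality of terms is asserted only between terms that both have the type in question, and all contexts and types mentioned are well-formed. * *Structural rules:* context formation (both regions may be extended by a type over $\Delta$) and its compatibility with equality; $\Delta,x:A,\Delta';\cdot\vdash x:A$ and $\Delta;x:A\vdash x:A$; judgemental equality is an equivalence relation, is a congruence for all type and term formers, and may be used to convert types and contexts in judgements; weakening and exchange in $\Delta$ (exchange of $x:A,x':A'$ when $A'$ is a type without $x$); exchange, but no weakening or contraction, in $\Xi$; substitution of terms $\Delta;\cdot\vdash a:A$ for intuitionistic variables; substitution of $\Delta;\Xi'\vdash a:A$ for $x$ in $\Delta;\Xi,x:A\vdash b:B$ (and in equalities of such terms), giving a result in $\Delta;\Xi,\Xi'$. * *$\Sigma$:*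 if $\Delta,x:A;\cdot\vdash B\ \mathrm{type}$ then $\Sigma_{!x:!A}B$ is a type over $\Delta$; from $\Delta;\cdot\vdash a:A$ and $\Delta;\Xi\vdash b:B[a/x]$ get $\Delta;\Xi\vdash {!a}\otimes b:\Sigma_{!x:!A}B$; from $\Delta;\cdot\vdash C\ \mathrm{type}$, $\Delta;\Xi\vdash t:\Sigma_{!x:!A}B$ and $\Delta,x:A;\Xi',y:B\vdash c:C$ get $\Delta;\Xi,\Xi'\vdash\mathrm{let}\ t\ \mathrm{be}\ {!x}\otimes y\ \mathrm{in}\ c:C$. * *$\Pi$:* if $\Delta,x:A;\cdot\vdash B\ \mathrm{type}$ then $\Pi_{!x:!A}B$ is a type over $\Delta$; from $\Delta,x:A;\Xi\vdash b:B$ with $\vdash\Delta;\Xi\ \mathrm{ctxt}$ get $\Delta;\Xi\vdash\lambda_{!x:!A}b:\Pi_{!x:!A}B$; from $\Delta;\cdot\vdash a:A$ and $\Delta;\Xi\vdash f:\Pi_{!x:!A}B$ get $\Delta;\Xi\vdash f(!a):B[a/x]$. * *(Extensional) $\mathrm{Id}$:* for $\Delta;\cdot\vdash a,a':A$, $\mathrm{Id}_{!A}(a,a')$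 is a type over $\Delta$, and $\Delta;\cdot\vdash\mathrm{refl}_{!a}:\mathrm{Id}_{!A}(a,a)$; from $\Delta,x:A,x':A;\cdot\vdash D\ \mathrm{type}$, $\Delta,z:A;\Xi\vdash d:D[z/x,z/x']$, $\Delta;\cdot\vdash a,a':A$ and $\Delta;\Xi'\vdash p:\mathrm{Id}_{!A}(a,a')$ get $\Delta;\Xi[a/z],\Xi'\vdash\mathrm{let}\ (a,a',p)\ \mathrm{be}\ (z,z,\mathrm{refl}_{!z})\ \mathrm{in}\ d:D[a/x,a'/x']$. * *$I,\otimes,\multimap,\top,\&,0,\oplus,!$:* the usual formation, introduction and elimination rules of dual intuitionistic linear logic with additives, over each $\Delta$; in particular $\Delta;\Xi\vdash\langle\rangle:\top$ always; $\Delta;\Xi\vdash t:0$ gives $\Delta;\Xi,\Xi'\vdash\mathrm{false}(t):B$; $\Delta;\cdot\vdash a:A$ gives $\Delta;\cdot\vdash{!a}:{!A}$; and $\Delta;\Xi\vdash t:{!A}$, $\Delta,x:A;\Xi'\vdash b:B$ (with $B$ a type over $\Delta$) give $\Delta;\Xi,\Xi'\vdash\mathrm{let}\ t\ \mathrm{be}\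 {!x}\ \mathrm{in}\ b:B$. * *Computation rules* ($\beta$), whenever the left-hand side is well typed: $\mathrm{let}\ {!a}\otimes b\ \mathrm{be}\ {!x}\otimes y\ \mathrm{in}\ c\equiv c[a/x,b/y]$; $(\lambda_{!x:!A}b)(!a)\equiv b[a/x]$; $\mathrm{let}\ (a,a,\mathrm{refl}_{!a})\ \mathrm{be}\ (z,z,\mathrm{refl}_{!z})\ \mathrm{in}\ d\equiv d[a/z]$; $\mathrm{let}\ *\ \mathrm{be}\ *\ \mathrm{in}\ a\equiv a$; $\mathrm{let}\ a\otimes b\ \mathrm{be}\ x\otimes y\ \mathrm{in}\ c\equiv c[a/x,b/y]$; $(\lambda_{x:A}b)(a)\equiv b[a/x]$; $\mathrm{fst}\langle a,b\rangle\equiv a$; $\mathrm{snd}\langle a,b\rangle\equiv b$; $\mathrm{case}$ of $\mathrm{inl}(a)$ is $\equiv c[a/x]$ and $\mathrm{case}$ of $\mathrm{inr}(b)$ is $\equiv d[b/y]$; $\mathrm{let}\ {!a}\ \mathrm{be}\ {!x}\ \mathrm{in}\ b\equiv b[a/x]$. * *Uniqueness rules* ($\eta$): $\mathrm{let}\ t\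 \mathrm{be}\ {!x}\otimes y\ \mathrm{in}\ {!x}\otimes y\equiv t$; $\lambda_{!x:!A}f(!x)\equiv f$; $\mathrm{let}\ (x,x',z)\ \mathrm{be}\ (w,w,\mathrm{refl}_{!w})\ \mathrm{in}\ c[w/x,w/x',\mathrm{refl}_{!w}/z]\equiv c$ in contexts $\Delta,x:A,x':A;\Xi,z:\mathrm{Id}_{!A}(x,x')$; $\mathrm{let}\ t\ \mathrm{be}\ *\ \mathrm{in}\ *\equiv t$; $\mathrm{let}\ t\ \mathrm{be}\ x\otimes y\ \mathrm{in}\ x\otimes y\equiv t$; $\lambda_{x:A}f(x)\equiv f$; $t\equiv\langle\rangle:\top$; $\langle\mathrm{fst}(t),\mathrm{snd}(t)\rangle\equiv t$; $\mathrm{false}(t)\equiv t:0$; $\mathrm{case}\ t\ \mathrm{of}\ \mathrm{inl}(x)\to\mathrm{inl}(x)\,\|\,\mathrm{inr}(y)\to\mathrm{inr}(y)\equiv t$; $\mathrm{let}\ t\ \mathrm{be}\ {!x}\ \mathrm{in}\ {!x}\equiv t$. * *Commuting conversions:* for every linear program context $C[-]$ (a term with one hole, in a linear position, i.e. not inside an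 argument $!a$, the $a$ of $\mathrm{refl}_{!a}$ or an endpoint in the eliminator for $\mathrm{Id}$) that binds no free variable of $a$, $b$ respectively $t$: $C[\mathrm{let}\ a\ \mathrm{be}\ b\ \mathrm{in}\ c]\equiv\mathrm{let}\ a\ \mathrm{be}\ b\ \mathrm{in}\ C[c]$ for all the $\mathrm{let}$-constructors, $C[\mathrm{false}(t)]\equiv\mathrm{false}(t)$, and $C[\mathrm{case}\ t\ \mathrm{of}\ \mathrm{inl}(x)\to c\,\|\,\mathrm{inr}(y)\to d]\equiv\mathrm{case}\ t\ \mathrm{of}\ \mathrm{inl}(x)\to C[c]\,\|\,\mathrm{inr}(y)\to C[d]$. **Theorem (Consistency).** ILDTT with all the type formers $\Sigma,\Pi,\mathrm{Id},I,\otimes,\multimap,\top,\&,0,\oplus,!$ is consistent 1. as a type theory: it is not the case that, for all $\Delta;\Xi$, $A$, $a$, $a'$ with $\Delta;\Xi\vdash a:A$ and $\Delta;\Xi\vdash a':A$ derivable, $\Delta;\Xi\vdash a\equiv a':A$ is derivable; and 2. as a logic: it is not the case that for every type $A$ in the empty context, $\cdot;\cdot\vdash A\ \mathrm{type}$, there is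 a term $a$ with $\cdot;\cdot\vdash a:A$ derivable. -/

import Mathlib

/-!
# Intuitionistic linear dependent type theory (ILDTT)

Raw syntax is nameless (de Bruijn indices), with two separate index spaces: one for the variables
of the intuitionistic region of a context and one for those of the linear region.
A region is a list of types whose head is the variable declared last, so the extension `Δ, x : A`
is `A :: Δ` and the concatenation `Δ, Δ'` is `Δ' ++ Δ`; index `0` is the head.
-/

namespace ILDTT

mutual
/-- Raw types. -/
inductive Ty : Type where
  /-- `Σ_{!x:!A} B`, binding an intuitionistic variable in `B` -/
  | sig (A B : Ty)
  /-- `Π_{!x:!A} B`, binding an intuitionistic variable in `B` -/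
  | pi (A B : Ty)
  /-- `Id_{!A}(a, a')` -/
  | idt (A : Ty) (a a' : Tm)
  /-- `I` -/
  | unit
  /-- `A ⊗ B` -/
  | tensor (A B : Ty)
  /-- `A ⊸ B` -/
  | lolli (A B : Ty)
  /-- `⊤` -/
  | top
  /-- `A & B` -/
  | and (A B : Ty)
  /-- `0` -/
  | zero
  /-- `A ⊕ B` -/
  | plus (A B : Ty)
  /-- `!A` -/
  | bang (A : Ty)

/-- Raw terms. -/
inductive Tm : Type where
  /-- intuitionistic variable -/
  | ivar (n : ℕ)
  /-- linear variable -/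
  | lvar (n : ℕ)
  /-- `!a ⊗ b : Σ_{!x:!A} B` -/
  | spair (a b : Tm)
  /-- `let t be !x ⊗ y in c`, binding an intuitionistic `x` and a linear `y` in `c` -/
  | slet (t c : Tm)
  /-- `λ_{!x:!A} b`, binding an intuitionistic variable in `b` -/
  | ilam (A : Ty) (b : Tm)
  /-- `f(!a)` -/
  | iapp (f a : Tm)
  /-- `refl_{!a}` -/
  | refl (a : Tm)
  /-- `let (a, a', p) be (z, z, refl_{!z}) in d`, binding an intuitionistic `z` in `d` -/
  | idlet (a a' p d : Tm)
  /-- `*` -/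
  | star
  /-- `let t be * in a` -/
  | letstar (t a : Tm)
  /-- `a ⊗ b` -/
  | tpair (a b : Tm)
  /-- `let t be x ⊗ y in c`, binding linear `x` (index `1`) and `y` (index `0`) in `c` -/
  | tlet (t c : Tm)
  /-- `λ_{x:A} b`, binding a linear variable in `b` -/
  | llam (A : Ty) (b : Tm)
  /-- `f(a)` -/
  | lapp (f a : Tm)
  /-- `⟨⟩` -/
  | nil
  /-- `⟨a, b⟩` -/
  | pair (a b : Tm)
  /-- `fst(t)` -/
  | fst (t : Tm)
  /-- `snd(t)` -/
  | snd (t : Tm)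
  /-- `false(t)` -/
  | abort (t : Tm)
  /-- `inl(a)` -/
  | inl (a : Tm)
  /-- `inr(b)` -/
  | inr (b : Tm)
  /-- `case t of inl(x) → c || inr(y) → d`, binding a linear variable in each branch -/
  | case (t c d : Tm)
  /-- `!a` -/
  | bang (a : Tm)
  /-- `let t be !x in b`, binding an intuitionistic variable in `b` -/
  | letbang (t b : Tm)
end

/-! ### Renaming and substitution -/

/-- Simultaneous renamings of intuitionistic and linear variables. -/
structure Ren where
  i : ℕ → ℕ
  l : ℕ → ℕ

/-- Lifting a function on indices under one binder. -/
def liftIdx (f : ℕ → ℕ) : ℕ → ℕ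
  | 0 => 0
  | n + 1 => f n + 1

/-- Renaming under an intuitionistic binder. -/
def Ren.upI (r : Ren) : Ren := ⟨liftIdx r.i, r.l⟩

/-- Renaming under a linear binder. -/
def Ren.upL (r : Ren) : Ren := ⟨r.i, liftIdx r.l⟩

/-- Weakening by `i` intuitionistic and `l` linear variables. -/
def Ren.shift (i l : ℕ) : Ren := ⟨fun n => n + i, fun n => n + l⟩

mutual
def Ty.ren (r : Ren) : Ty → Ty
  | .sig A B => .sig (A.ren r) (B.ren r.upI)
  | .pi A B => .pi (A.ren r) (B.ren r.upI)
  | .idt A a a' => .idt (A.ren r) (a.ren r) (a'.ren r)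
  | .unit => .unit
  | .tensor A B => .tensor (A.ren r) (B.ren r)
  | .lolli A B => .lolli (A.ren r) (B.ren r)
  | .top => .top
  | .and A B => .and (A.ren r) (B.ren r)
  | .zero => .zero
  | .plus A B => .plus (A.ren r) (B.ren r)
  | .bang A => .bang (A.ren r)

def Tm.ren (r : Ren) : Tm → Tm
  | .ivar n => .ivar (r.i n)
  | .lvar n => .lvar (r.l n)
  | .spair a b => .spair (a.ren r) (b.ren r)
  | .slet t c => .slet (t.ren r) (c.ren r.upI.upL)
  | .ilam A b => .ilam (A.ren r) (b.ren r.upI)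
  | .iapp f a => .iapp (f.ren r) (a.ren r)
  | .refl a => .refl (a.ren r)
  | .idlet a a' p d => .idlet (a.ren r) (a'.ren r) (p.ren r) (d.ren r.upI)
  | .star => .star
  | .letstar t a => .letstar (t.ren r) (a.ren r)
  | .tpair a b => .tpair (a.ren r) (b.ren r)
  | .tlet t c => .tlet (t.ren r) (c.ren r.upL.upL)
  | .llam A b => .llam (A.ren r) (b.ren r.upL)
  | .lapp f a => .lapp (f.ren r) (a.ren r)
  | .nil => .nil
  | .pair a b => .pair (a.ren r) (b.ren r)
  | .fst t => .fst (t.ren r)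
  | .snd t => .snd (t.ren r)
  | .abort t => .abort (t.ren r)
  | .inl a => .inl (a.ren r)
  | .inr b => .inr (b.ren r)
  | .case t c d => .case (t.ren r) (c.ren r.upL) (d.ren r.upL)
  | .bang a => .bang (a.ren r)
  | .letbang t b => .letbang (t.ren r) (b.ren r.upI)
end

/-- Weakening of a type by one intuitionistic variable. -/
def Ty.wk (A : Ty) : Ty := A.ren (Ren.shift 1 0)

/-- Weakening of a term by one intuitionistic variable. -/
def Tm.wk (a : Tm) : Tm := a.ren (Ren.shift 1 0)

/-- Weakening of a term by `k` linear variables. -/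
def Tm.wkL (k : ℕ) (a : Tm) : Tm := a.ren (Ren.shift 0 k)

/-- Simultaneous substitutions for intuitionistic and linear variables. -/
structure Sub where
  i : ℕ → Tm
  l : ℕ → Tm

/-- Substitution under an intuitionistic binder. -/
def Sub.upI (s : Sub) : Sub where
  i
    | 0 => .ivar 0
    | n + 1 => (s.i n).ren (Ren.shift 1 0)
  l n := (s.l n).ren (Ren.shift 1 0)

/-- Substitution under a linear binder. -/
def Sub.upL (s : Sub) : Sub where
  i n := (s.i n).ren (Ren.shift 0 1)
  l
    | 0 => .lvar 0
    | n + 1 => (s.l n).ren (Ren.shift 0 1)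

mutual
def Ty.subst (s : Sub) : Ty → Ty
  | .sig A B => .sig (A.subst s) (B.subst s.upI)
  | .pi A B => .pi (A.subst s) (B.subst s.upI)
  | .idt A a a' => .idt (A.subst s) (a.subst s) (a'.subst s)
  | .unit => .unit
  | .tensor A B => .tensor (A.subst s) (B.subst s)
  | .lolli A B => .lolli (A.subst s) (B.subst s)
  | .top => .top
  | .and A B => .and (A.subst s) (B.subst s)
  | .zero => .zero
  | .plus A B => .plus (A.subst s) (B.subst s)
  | .bang A => .bang (A.subst s)

def Tm.subst (s : Sub) : Tm → Tm
  | .ivar n => s.i n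
  | .lvar n => s.l n
  | .spair a b => .spair (a.subst s) (b.subst s)
  | .slet t c => .slet (t.subst s) (c.subst s.upI.upL)
  | .ilam A b => .ilam (A.subst s) (b.subst s.upI)
  | .iapp f a => .iapp (f.subst s) (a.subst s)
  | .refl a => .refl (a.subst s)
  | .idlet a a' p d => .idlet (a.subst s) (a'.subst s) (p.subst s) (d.subst s.upI)
  | .star => .star
  | .letstar t a => .letstar (t.subst s) (a.subst s)
  | .tpair a b => .tpair (a.subst s) (b.subst s)
  | .tlet t c => .tlet (t.subst s) (c.subst s.upL.upL)
  | .llam A b => .llam (A.subst s) (b.subst s.upL)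
  | .lapp f a => .lapp (f.subst s) (a.subst s)
  | .nil => .nil
  | .pair a b => .pair (a.subst s) (b.subst s)
  | .fst t => .fst (t.subst s)
  | .snd t => .snd (t.subst s)
  | .abort t => .abort (t.subst s)
  | .inl a => .inl (a.subst s)
  | .inr b => .inr (b.subst s)
  | .case t c d => .case (t.subst s) (c.subst s.upL) (d.subst s.upL)
  | .bang a => .bang (a.subst s)
  | .letbang t b => .letbang (t.subst s) (b.subst s.upI)
end

/-- The identity substitution. -/
def Sub.id : Sub := ⟨.ivar, .lvar⟩

/-- Adjoin a value for a new intuitionistic variable `0`. -/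
def Sub.consI (a : Tm) (s : Sub) : Sub where
  i
    | 0 => a
    | n + 1 => s.i n
  l := s.l

/-- Adjoin a value for a new linear variable `0`. -/
def Sub.consL (a : Tm) (s : Sub) : Sub where
  i := s.i
  l
    | 0 => a
    | n + 1 => s.l n

/-- `B[a/x]` for the last intuitionistic variable `x`. -/
def Ty.instI (B : Ty) (a : Tm) : Ty := B.subst (Sub.id.consI a)

/-- `b[a/x]` for the last intuitionistic variable `x`. -/
def Tm.instI (b a : Tm) : Tm := b.subst (Sub.id.consI a)

/-- `b[a/x]` for the last linear variable `x`, everything else staying in place. -/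
def Tm.instL (b a : Tm) : Tm := b.subst (Sub.id.consL a)

/-- `b[a/x]` where `b` lives over `Ξ, x : A` and `a` over `Ξ'` with `k` variables; the result lives
over `Ξ, Ξ'`. -/
def Tm.cutL (b a : Tm) (k : ℕ) : Tm :=
  b.subst (Sub.consL a ⟨.ivar, fun n => .lvar (n + k)⟩)

/-! ### Contexts and judgements -/

/-- Renaming of a telescope `Δ'` over `Δ` along a renaming of `Δ`. -/
def renTele (r : Ren) : List Ty → List Ty
  | [] => []
  | A :: Δ' => A.ren (Ren.upI^[Δ'.length] r) :: renTele r Δ'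

/-- Substitution in a telescope `Δ'` over `Δ` along a substitution for `Δ`. -/
def substTele (s : Sub) : List Ty → List Ty
  | [] => []
  | A :: Δ' => A.subst (Sub.upI^[Δ'.length] s) :: substTele s Δ'

/-- Weakening of a linear region by one intuitionistic variable. -/
def wkCtx (Ξ : List Ty) : List Ty := Ξ.map Ty.wk

/-- What stands to the right of the turnstile. -/
inductive Body : Type where
  /-- `A type` -/
  | ty (A : Ty)
  /-- `A ≡ A' type` -/
  | tyEq (A A' : Ty)
  /-- `a : A` -/
  | tm (a : Tm) (A : Ty)
  /-- `a ≡ a' : A` -/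
  | tmEq (a a' : Tm) (A : Ty)

def Body.ren (r : Ren) : Body → Body
  | .ty A => .ty (A.ren r)
  | .tyEq A A' => .tyEq (A.ren r) (A'.ren r)
  | .tm a A => .tm (a.ren r) (A.ren r)
  | .tmEq a a' A => .tmEq (a.ren r) (a'.ren r) (A.ren r)

def Body.subst (s : Sub) : Body → Body
  | .ty A => .ty (A.subst s)
  | .tyEq A A' => .tyEq (A.subst s) (A'.subst s)
  | .tm a A => .tm (a.subst s) (A.subst s)
  | .tmEq a a' A => .tmEq (a.subst s) (a'.subst s) (A.subst s)

/-- Renaming of linear variables. These do not occur free in types, so only terms are affected. -/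
def Body.renL (f : ℕ → ℕ) : Body → Body
  | .ty A => .ty A
  | .tyEq A A' => .tyEq A A'
  | .tm a A => .tm (a.ren ⟨id, f⟩) A
  | .tmEq a a' A => .tmEq (a.ren ⟨id, f⟩) (a'.ren ⟨id, f⟩) A

/-- Judgements of ILDTT. Types and type equalities are only ever derived with an empty linear
region. -/
inductive Judgement : Type where
  /-- `⊢ Δ; Ξ ctxt` -/
  | ctx (Δ Ξ : List Ty)
  /-- `⊢ Δ; Ξ ≡ Δ'; Ξ' ctxt` -/
  | ctxEq (Δ Ξ Δ' Ξ' : List Ty)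
  /-- `Δ; Ξ ⊢ J` -/
  | ent (Δ Ξ : List Ty) (J : Body)

/-- Swap the last two variables. -/
def swapIdx : ℕ → ℕ
  | 0 => 1
  | 1 => 0
  | n + 2 => n + 2

/-! ### Linear program contexts -/

/-- One layer of a linear program context: a term former with a hole in one of its linear argument
positions. Arguments `!a`, which must not use linear variables (in `!a`, `f(!a)`, `!a ⊗ b`,
`refl_{!a}`, and the endpoints in the eliminator for `Id`), are not linear positions. -/
inductive Frame : Type where
  | spairR (a : Tm)
  | sletT (c : Tm)
  | sletB (t : Tm)
  | ilam (A : Ty)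
  | iappF (a : Tm)
  | idletP (a a' d : Tm)
  | idletB (a a' p : Tm)
  | letstarT (a : Tm)
  | letstarB (t : Tm)
  | tpairL (b : Tm)
  | tpairR (a : Tm)
  | tletT (c : Tm)
  | tletB (t : Tm)
  | llam (A : Ty)
  | lappF (a : Tm)
  | lappA (f : Tm)
  | pairL (b : Tm)
  | pairR (a : Tm)
  | fst
  | snd
  | abort
  | inl
  | inr
  | caseT (c d : Tm)
  | caseL (t d : Tm)
  | caseR (t c : Tm)
  | letbangT (b : Tm)
  | letbangB (t : Tm)

/-- Fill the hole; variables may be captured. -/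
def Frame.plug : Frame → Tm → Tm
  | .spairR a, e => .spair a e
  | .sletT c, e => .slet e c
  | .sletB t, e => .slet t e
  | .ilam A, e => .ilam A e
  | .iappF a, e => .iapp e a
  | .idletP a a' d, e => .idlet a a' e d
  | .idletB a a' p, e => .idlet a a' p e
  | .letstarT a, e => .letstar e a
  | .letstarB t, e => .letstar t e
  | .tpairL b, e => .tpair e b
  | .tpairR a, e => .tpair a e
  | .tletT c, e => .tlet e c
  | .tletB t, e => .tlet t e
  | .llam A, e => .llam A e
  | .lappF a, e => .lapp e a
  | .lappA f, e => .lapp f e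
  | .pairL b, e => .pair e b
  | .pairR a, e => .pair a e
  | .fst, e => .fst e
  | .snd, e => .snd e
  | .abort, e => .abort e
  | .inl, e => .inl e
  | .inr, e => .inr e
  | .caseT c d, e => .case e c d
  | .caseL t d, e => .case t e d
  | .caseR t c, e => .case t c e
  | .letbangT b, e => .letbang e b
  | .letbangB t, e => .letbang t e

/-- Number of intuitionistic variables bound at the hole. -/
def Frame.bindI : Frame → ℕ
  | .sletB _ => 1
  | .ilam _ => 1
  | .idletB _ _ _ => 1
  | .letbangB _ => 1
  | _ => 0

/-- Number of linear variables bound at the hole. -/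
def Frame.bindL : Frame → ℕ
  | .sletB _ => 1
  | .tletB _ => 2
  | .llam _ => 1
  | .caseL _ _ => 1
  | .caseR _ _ => 1
  | _ => 0

def Frame.ren (r : Ren) : Frame → Frame
  | .spairR a => .spairR (a.ren r)
  | .sletT c => .sletT (c.ren r.upI.upL)
  | .sletB t => .sletB (t.ren r)
  | .ilam A => .ilam (A.ren r)
  | .iappF a => .iappF (a.ren r)
  | .idletP a a' d => .idletP (a.ren r) (a'.ren r) (d.ren r.upI)
  | .idletB a a' p => .idletB (a.ren r) (a'.ren r) (p.ren r)
  | .letstarT a => .letstarT (a.ren r)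
  | .letstarB t => .letstarB (t.ren r)
  | .tpairL b => .tpairL (b.ren r)
  | .tpairR a => .tpairR (a.ren r)
  | .tletT c => .tletT (c.ren r.upL.upL)
  | .tletB t => .tletB (t.ren r)
  | .llam A => .llam (A.ren r)
  | .lappF a => .lappF (a.ren r)
  | .lappA f => .lappA (f.ren r)
  | .pairL b => .pairL (b.ren r)
  | .pairR a => .pairR (a.ren r)
  | .fst => .fst
  | .snd => .snd
  | .abort => .abort
  | .inl => .inl
  | .inr => .inr
  | .caseT c d => .caseT (c.ren r.upL) (d.ren r.upL)
  | .caseL t d => .caseL (t.ren r) (d.ren r.upL)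
  | .caseR t c => .caseR (t.ren r) (c.ren r.upL)
  | .letbangT b => .letbangT (b.ren r.upI)
  | .letbangB t => .letbangB (t.ren r)

/-- The frames `let a be b in [-]`, for each of the `let`-constructors. -/
def Frame.IsLet : Frame → Prop
  | .sletB _ => True
  | .idletB _ _ _ => True
  | .letstarB _ => True
  | .tletB _ => True
  | .letbangB _ => True
  | _ => False

/-- A linear program context `C[-]`: a list of frames, the outermost first. -/
abbrev PCtx := List Frame

/-- `C[e]` -/
def PCtx.plug : PCtx → Tm → Tm
  | [], e => e
  | F :: C, e => F.plug (PCtx.plug C e)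

/-- Number of intuitionistic variables that `C[-]` binds at its hole. -/
def PCtx.bindI (C : PCtx) : ℕ := (C.map Frame.bindI).sum

/-- Number of linear variables that `C[-]` binds at its hole. -/
def PCtx.bindL (C : PCtx) : ℕ := (C.map Frame.bindL).sum

def PCtx.ren (r : Ren) : PCtx → PCtx
  | [] => []
  | F :: C => F.ren r :: PCtx.ren (Ren.upL^[F.bindL] (Ren.upI^[F.bindI] r)) C

/-- Exchange of two adjacent blocks of bound variables: the last `p` variables and the `k`
variables just before them. -/
def blockSwap (p k n : ℕ) : ℕ :=
  if n < p then n + k else if n < p + k then n - p else n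

/-- Renaming of a term under the binders of `C` followed by `p` intuitionistic and `q` linear
binders to the same term under these `p` and `q` binders followed by the binders of `C`. -/
def PCtx.exch (C : PCtx) (p q : ℕ) : Ren := ⟨blockSwap p C.bindI, blockSwap q C.bindL⟩

/-! ### Derivability

Besides the premises that are customarily displayed, a rule has as premises those presuppositions
of its conclusion (contexts and types are well-formed, both sides of an equation have the type)
that the displayed premises do not already guarantee. -/

/-- The derivable judgements of ILDTT with all its type formers
`Σ`, `Π`, `Id`, `I`, `⊗`, `⊸`, `⊤`, `&`, `0`, `⊕`, `!`. -/
inductive Derivable : Judgement → Prop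
  /- Context formation -/
  | cEmp : Derivable (.ctx [] [])
  | intCExt {Δ Ξ A} :
      Derivable (.ctx Δ Ξ) → Derivable (.ent Δ [] (.ty A)) →
      Derivable (.ctx (A :: Δ) (wkCtx Ξ))
  | intCExtEq {Δ Ξ Δ' Ξ' A B} :
      Derivable (.ctxEq Δ Ξ Δ' Ξ') → Derivable (.ent Δ [] (.tyEq A B)) →
      Derivable (.ctxEq (A :: Δ) (wkCtx Ξ) (B :: Δ') (wkCtx Ξ'))
  | linCExt {Δ Ξ A} :
      Derivable (.ctx Δ Ξ) → Derivable (.ent Δ [] (.ty A)) →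
      Derivable (.ctx Δ (A :: Ξ))
  | linCExtEq {Δ Ξ Δ' Ξ' A B} :
      Derivable (.ctxEq Δ Ξ Δ' Ξ') → Derivable (.ent Δ [] (.tyEq A B)) →
      Derivable (.ctxEq Δ (A :: Ξ) Δ' (B :: Ξ'))
  /- Variables -/
  | intVar {Δ A} (Δ') :
      Derivable (.ctx (Δ' ++ A :: Δ) []) →
      Derivable (.ent (Δ' ++ A :: Δ) []
        (.tm (.ivar Δ'.length) (A.ren (Ren.shift (Δ'.length + 1) 0))))
  | linVar {Δ A} :
      Derivable (.ctx Δ [A]) → Derivable (.ent Δ [A] (.tm (.lvar 0) A))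
  /- Judgemental equality is an equivalence relation -/
  | cEqR {Δ Ξ} : Derivable (.ctx Δ Ξ) → Derivable (.ctxEq Δ Ξ Δ Ξ)
  | cEqS {Δ Ξ Δ' Ξ'} : Derivable (.ctxEq Δ Ξ Δ' Ξ') → Derivable (.ctxEq Δ' Ξ' Δ Ξ)
  | cEqT {Δ Ξ Δ' Ξ' Δ'' Ξ''} :
      Derivable (.ctxEq Δ Ξ Δ' Ξ') → Derivable (.ctxEq Δ' Ξ' Δ'' Ξ'') →
      Derivable (.ctxEq Δ Ξ Δ'' Ξ'')
  | tyEqR {Δ Ξ A} : Derivable (.ent Δ Ξ (.ty A)) → Derivable (.ent Δ Ξ (.tyEq A A))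
  | tyEqS {Δ Ξ A A'} :
      Derivable (.ent Δ Ξ (.tyEq A A')) → Derivable (.ent Δ Ξ (.tyEq A' A))
  | tyEqT {Δ Ξ A A' A''} :
      Derivable (.ent Δ Ξ (.tyEq A A')) → Derivable (.ent Δ Ξ (.tyEq A' A'')) →
      Derivable (.ent Δ Ξ (.tyEq A A''))
  | tmEqR {Δ Ξ a A} : Derivable (.ent Δ Ξ (.tm a A)) → Derivable (.ent Δ Ξ (.tmEq a a A))
  | tmEqS {Δ Ξ a a' A} :
      Derivable (.ent Δ Ξ (.tmEq a a' A)) → Derivable (.ent Δ Ξ (.tmEq a' a A))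
  | tmEqT {Δ Ξ a a' a'' A} :
      Derivable (.ent Δ Ξ (.tmEq a a' A)) → Derivable (.ent Δ Ξ (.tmEq a' a'' A)) →
      Derivable (.ent Δ Ξ (.tmEq a a'' A))
  /- Conversion -/
  | tmConv {Δ Ξ Δ' Ξ' a A A'} :
      Derivable (.ent Δ Ξ (.tm a A)) → Derivable (.ctxEq Δ Ξ Δ' Ξ') →
      Derivable (.ent Δ [] (.tyEq A A')) →
      Derivable (.ent Δ' Ξ' (.tm a A'))
  | tmEqConv {Δ Ξ Δ' Ξ' a a' A A'} :
      Derivable (.ent Δ Ξ (.tmEq a a' A)) → Derivable (.ctxEq Δ Ξ Δ' Ξ') →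
      Derivable (.ent Δ [] (.tyEq A A')) →
      Derivable (.ent Δ' Ξ' (.tmEq a a' A'))
  | tyConv {Δ Δ' A} :
      Derivable (.ent Δ [] (.ty A)) → Derivable (.ctxEq Δ [] Δ' []) →
      Derivable (.ent Δ' [] (.ty A))
  | tyEqConv {Δ Δ' A A'} :
      Derivable (.ent Δ [] (.tyEq A A')) → Derivable (.ctxEq Δ [] Δ' []) →
      Derivable (.ent Δ' [] (.tyEq A A'))
  /- Weakening, exchange and substitution -/
  | intWeak {Δ Ξ A J} (Δ') :
      Derivable (.ent (Δ' ++ Δ) Ξ J) → Derivable (.ent Δ [] (.ty A)) →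
      Derivable (.ent (renTele (Ren.shift 1 0) Δ' ++ A :: Δ)
        (Ξ.map (Ty.ren (Ren.upI^[Δ'.length] (Ren.shift 1 0))))
        (J.ren (Ren.upI^[Δ'.length] (Ren.shift 1 0))))
  | intExch {Δ Ξ A A' J} (Δ') :
      Derivable (.ent (Δ' ++ A'.wk :: A :: Δ) Ξ J) → Derivable (.ent Δ [] (.ty A')) →
      Derivable (.ent (renTele ⟨swapIdx, id⟩ Δ' ++ A.wk :: A' :: Δ)
        (Ξ.map (Ty.ren (Ren.upI^[Δ'.length] ⟨swapIdx, id⟩)))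
        (J.ren (Ren.upI^[Δ'.length] ⟨swapIdx, id⟩)))
  | linExch {Δ Ξ A A' J} (Ξ') :
      Derivable (.ent Δ (Ξ' ++ A' :: A :: Ξ) J) →
      Derivable (.ent Δ (Ξ' ++ A :: A' :: Ξ) (J.renL (liftIdx^[Ξ'.length] swapIdx)))
  | intSubst {Δ Ξ A a J} (Δ') :
      Derivable (.ent (Δ' ++ A :: Δ) Ξ J) → Derivable (.ent Δ [] (.tm a A)) →
      Derivable (.ent (substTele (Sub.id.consI a) Δ' ++ Δ)
        (Ξ.map (Ty.subst (Sub.upI^[Δ'.length] (Sub.id.consI a))))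
        (J.subst (Sub.upI^[Δ'.length] (Sub.id.consI a))))
  | linTmSubst {Δ Ξ Ξ' A a b B} :
      Derivable (.ent Δ (A :: Ξ) (.tm b B)) → Derivable (.ent Δ Ξ' (.tm a A)) →
      Derivable (.ent Δ (Ξ' ++ Ξ) (.tm (b.cutL a Ξ'.length) B))
  | linTmSubstEq {Δ Ξ Ξ' A a b b' B} :
      Derivable (.ent Δ (A :: Ξ) (.tmEq b b' B)) → Derivable (.ent Δ Ξ' (.tm a A)) →
      Derivable (.ent Δ (Ξ' ++ Ξ) (.tmEq (b.cutL a Ξ'.length) (b'.cutL a Ξ'.length) B))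
  /- `Σ`-types -/
  | sigF {Δ A B} :
      Derivable (.ent (A :: Δ) [] (.ty B)) → Derivable (.ent Δ [] (.ty (.sig A B)))
  | sigI {Δ Ξ A B a b} :
      Derivable (.ent (A :: Δ) [] (.ty B)) →
      Derivable (.ent Δ [] (.tm a A)) → Derivable (.ent Δ Ξ (.tm b (B.instI a))) →
      Derivable (.ent Δ Ξ (.tm (.spair a b) (.sig A B)))
  | sigE {Δ Ξ Ξ' A B C t c} :
      Derivable (.ctx Δ Ξ') → Derivable (.ent Δ [] (.ty C)) →
      Derivable (.ent Δ Ξ (.tm t (.sig A B))) →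
      Derivable (.ent (A :: Δ) (B :: wkCtx Ξ') (.tm c C.wk)) →
      Derivable (.ent Δ (Ξ' ++ Ξ) (.tm (.slet (t.wkL Ξ'.length) c) C))
  | sigC {Δ Ξ a b c C} :
      Derivable (.ent Δ Ξ (.tm (.slet (.spair a b) c) C)) →
      Derivable (.ent Δ Ξ (.tmEq (.slet (.spair a b) c)
        (c.subst ((Sub.id.consI a).consL b)) C))
  | sigU {Δ Ξ A B t} :
      Derivable (.ent Δ Ξ (.tm (.slet t (.spair (.ivar 0) (.lvar 0))) (.sig A B))) →
      Derivable (.ent Δ Ξ (.tm t (.sig A B))) →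
      Derivable (.ent Δ Ξ (.tmEq (.slet t (.spair (.ivar 0) (.lvar 0))) t (.sig A B)))
  /- `Π`-types -/
  | piF {Δ A B} :
      Derivable (.ent (A :: Δ) [] (.ty B)) → Derivable (.ent Δ [] (.ty (.pi A B)))
  | piI {Δ Ξ A B b} :
      Derivable (.ctx Δ Ξ) → Derivable (.ent (A :: Δ) (wkCtx Ξ) (.tm b B)) →
      Derivable (.ent Δ Ξ (.tm (.ilam A b) (.pi A B)))
  | piE {Δ Ξ A B f a} :
      Derivable (.ent Δ [] (.tm a A)) → Derivable (.ent Δ Ξ (.tm f (.pi A B))) →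
      Derivable (.ent Δ Ξ (.tm (.iapp f a) (B.instI a)))
  | piC {Δ Ξ A a b C} :
      Derivable (.ent Δ Ξ (.tm (.iapp (.ilam A b) a) C)) →
      Derivable (.ent Δ Ξ (.tmEq (.iapp (.ilam A b) a) (b.instI a) C))
  | piU {Δ Ξ A B f} :
      Derivable (.ent Δ Ξ (.tm (.ilam A (.iapp f.wk (.ivar 0))) (.pi A B))) →
      Derivable (.ent Δ Ξ (.tm f (.pi A B))) →
      Derivable (.ent Δ Ξ (.tmEq f (.ilam A (.iapp f.wk (.ivar 0))) (.pi A B)))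
  /- `Id`-types; in `D` and `c` below, `x` has index `1` and `x'` has index `0` -/
  | idF {Δ A a a'} :
      Derivable (.ent Δ [] (.tm a A)) → Derivable (.ent Δ [] (.tm a' A)) →
      Derivable (.ent Δ [] (.ty (.idt A a a')))
  | idI {Δ A a} :
      Derivable (.ent Δ [] (.tm a A)) → Derivable (.ent Δ [] (.tm (.refl a) (.idt A a a)))
  | idE {Δ Ξ Ξ' A D d a a' p} :
      Derivable (.ent (A.wk :: A :: Δ) [] (.ty D)) →
      Derivable (.ent (A :: Δ) Ξ (.tm d (D.instI (.ivar 0)))) →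
      Derivable (.ent Δ [] (.tm a A)) → Derivable (.ent Δ [] (.tm a' A)) →
      Derivable (.ent Δ Ξ' (.tm p (.idt A a a'))) →
      Derivable (.ent Δ (Ξ' ++ Ξ.map (fun B => B.instI a))
        (.tm (.idlet a a' p (d.wkL Ξ'.length))
          (D.subst ((Sub.id.consI a).consI a'))))
  | idC {Δ Ξ a d C} :
      Derivable (.ent Δ Ξ (.tm (.idlet a a (.refl a) d) C)) →
      Derivable (.ent Δ Ξ (.tmEq (.idlet a a (.refl a) d) (d.instI a) C))
  /-- The body of the `let` is `c[w/x, w/x', refl_{!w}/z]`, with `w` the variable it binds. -/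
  | idU {Δ Ξ A c d C} :
      d = c.subst ⟨fun | 0 => .ivar 0 | n + 1 => .ivar (if n = 0 then 0 else n + 2),
        fun | 0 => .refl (.ivar 0) | n + 1 => .lvar (n + 1)⟩ →
      Derivable (.ent (A.wk :: A :: Δ) (.idt A.wk.wk (.ivar 1) (.ivar 0) :: Ξ)
        (.tm (.idlet (.ivar 1) (.ivar 0) (.lvar 0) d) C)) →
      Derivable (.ent (A.wk :: A :: Δ) (.idt A.wk.wk (.ivar 1) (.ivar 0) :: Ξ) (.tm c C)) →
      Derivable (.ent (A.wk :: A :: Δ) (.idt A.wk.wk (.ivar 1) (.ivar 0) :: Ξ)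
        (.tmEq (.idlet (.ivar 1) (.ivar 0) (.lvar 0) d) c C))
  /- `I` -/
  | unitF {Δ} : Derivable (.ctx Δ []) → Derivable (.ent Δ [] (.ty .unit))
  | unitI {Δ} : Derivable (.ctx Δ []) → Derivable (.ent Δ [] (.tm .star .unit))
  | unitE {Δ Ξ Ξ' t a A} :
      Derivable (.ent Δ Ξ' (.tm t .unit)) → Derivable (.ent Δ Ξ (.tm a A)) →
      Derivable (.ent Δ (Ξ' ++ Ξ) (.tm (.letstar t (a.wkL Ξ'.length)) A))
  | unitC {Δ Ξ a A} :
      Derivable (.ent Δ Ξ (.tm (.letstar .star a) A)) →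
      Derivable (.ent Δ Ξ (.tmEq (.letstar .star a) a A))
  | unitU {Δ Ξ t} :
      Derivable (.ent Δ Ξ (.tm (.letstar t .star) .unit)) →
      Derivable (.ent Δ Ξ (.tm t .unit)) →
      Derivable (.ent Δ Ξ (.tmEq (.letstar t .star) t .unit))
  /- `⊗` -/
  | tensorF {Δ A B} :
      Derivable (.ent Δ [] (.ty A)) → Derivable (.ent Δ [] (.ty B)) →
      Derivable (.ent Δ [] (.ty (.tensor A B)))
  | tensorI {Δ Ξ Ξ' a b A B} :
      Derivable (.ent Δ Ξ (.tm a A)) → Derivable (.ent Δ Ξ' (.tm b B)) →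
      Derivable (.ent Δ (Ξ' ++ Ξ) (.tm (.tpair (a.wkL Ξ'.length) b) (.tensor A B)))
  | tensorE {Δ Ξ Ξ' t c A B C} :
      Derivable (.ent Δ Ξ (.tm t (.tensor A B))) →
      Derivable (.ent Δ (B :: A :: Ξ') (.tm c C)) →
      Derivable (.ent Δ (Ξ' ++ Ξ) (.tm (.tlet (t.wkL Ξ'.length) c) C))
  | tensorC {Δ Ξ a b c C} :
      Derivable (.ent Δ Ξ (.tm (.tlet (.tpair a b) c) C)) →
      Derivable (.ent Δ Ξ (.tmEq (.tlet (.tpair a b) c)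
        (c.subst ((Sub.id.consL a).consL b)) C))
  | tensorU {Δ Ξ t A B} :
      Derivable (.ent Δ Ξ (.tm (.tlet t (.tpair (.lvar 1) (.lvar 0))) (.tensor A B))) →
      Derivable (.ent Δ Ξ (.tm t (.tensor A B))) →
      Derivable (.ent Δ Ξ (.tmEq (.tlet t (.tpair (.lvar 1) (.lvar 0))) t (.tensor A B)))
  /- `⊸` -/
  | lolliF {Δ A B} :
      Derivable (.ent Δ [] (.ty A)) → Derivable (.ent Δ [] (.ty B)) →
      Derivable (.ent Δ [] (.ty (.lolli A B)))
  | lolliI {Δ Ξ A B b} :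
      Derivable (.ent Δ (A :: Ξ) (.tm b B)) →
      Derivable (.ent Δ Ξ (.tm (.llam A b) (.lolli A B)))
  | lolliE {Δ Ξ Ξ' f a A B} :
      Derivable (.ent Δ Ξ (.tm f (.lolli A B))) → Derivable (.ent Δ Ξ' (.tm a A)) →
      Derivable (.ent Δ (Ξ' ++ Ξ) (.tm (.lapp (f.wkL Ξ'.length) a) B))
  | lolliC {Δ Ξ A a b B} :
      Derivable (.ent Δ Ξ (.tm (.lapp (.llam A b) a) B)) →
      Derivable (.ent Δ Ξ (.tmEq (.lapp (.llam A b) a) (b.instL a) B))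
  | lolliU {Δ Ξ A B f} :
      Derivable (.ent Δ Ξ (.tm (.llam A (.lapp (f.wkL 1) (.lvar 0))) (.lolli A B))) →
      Derivable (.ent Δ Ξ (.tm f (.lolli A B))) →
      Derivable (.ent Δ Ξ (.tmEq (.llam A (.lapp (f.wkL 1) (.lvar 0))) f (.lolli A B)))
  /- `⊤` -/
  | topF {Δ} : Derivable (.ctx Δ []) → Derivable (.ent Δ [] (.ty .top))
  | topI {Δ Ξ} : Derivable (.ctx Δ Ξ) → Derivable (.ent Δ Ξ (.tm .nil .top))
  | topU {Δ Ξ t} :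
      Derivable (.ent Δ Ξ (.tm t .top)) → Derivable (.ent Δ Ξ (.tmEq t .nil .top))
  /- `&` -/
  | andF {Δ A B} :
      Derivable (.ent Δ [] (.ty A)) → Derivable (.ent Δ [] (.ty B)) →
      Derivable (.ent Δ [] (.ty (.and A B)))
  | andI {Δ Ξ a b A B} :
      Derivable (.ent Δ Ξ (.tm a A)) → Derivable (.ent Δ Ξ (.tm b B)) →
      Derivable (.ent Δ Ξ (.tm (.pair a b) (.and A B)))
  | andE1 {Δ Ξ t A B} :
      Derivable (.ent Δ Ξ (.tm t (.and A B))) → Derivable (.ent Δ Ξ (.tm (.fst t) A))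
  | andE2 {Δ Ξ t A B} :
      Derivable (.ent Δ Ξ (.tm t (.and A B))) → Derivable (.ent Δ Ξ (.tm (.snd t) B))
  | andC1 {Δ Ξ a b A} :
      Derivable (.ent Δ Ξ (.tm (.fst (.pair a b)) A)) →
      Derivable (.ent Δ Ξ (.tmEq (.fst (.pair a b)) a A))
  | andC2 {Δ Ξ a b B} :
      Derivable (.ent Δ Ξ (.tm (.snd (.pair a b)) B)) →
      Derivable (.ent Δ Ξ (.tmEq (.snd (.pair a b)) b B))
  | andU {Δ Ξ t A B} :
      Derivable (.ent Δ Ξ (.tm (.pair (.fst t) (.snd t)) (.and A B))) →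
      Derivable (.ent Δ Ξ (.tm t (.and A B))) →
      Derivable (.ent Δ Ξ (.tmEq (.pair (.fst t) (.snd t)) t (.and A B)))
  /- `0` -/
  | zeroF {Δ} : Derivable (.ctx Δ []) → Derivable (.ent Δ [] (.ty .zero))
  | zeroE {Δ Ξ Ξ' t B} :
      Derivable (.ctx Δ Ξ') → Derivable (.ent Δ [] (.ty B)) →
      Derivable (.ent Δ Ξ (.tm t .zero)) →
      Derivable (.ent Δ (Ξ' ++ Ξ) (.tm (.abort (t.wkL Ξ'.length)) B))
  | zeroU {Δ Ξ t} :
      Derivable (.ent Δ Ξ (.tm t .zero)) → Derivable (.ent Δ Ξ (.tmEq (.abort t) t .zero))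
  /- `⊕` -/
  | plusF {Δ A B} :
      Derivable (.ent Δ [] (.ty A)) → Derivable (.ent Δ [] (.ty B)) →
      Derivable (.ent Δ [] (.ty (.plus A B)))
  | plusI1 {Δ Ξ a A B} :
      Derivable (.ent Δ [] (.ty B)) → Derivable (.ent Δ Ξ (.tm a A)) →
      Derivable (.ent Δ Ξ (.tm (.inl a) (.plus A B)))
  | plusI2 {Δ Ξ b A B} :
      Derivable (.ent Δ [] (.ty A)) → Derivable (.ent Δ Ξ (.tm b B)) →
      Derivable (.ent Δ Ξ (.tm (.inr b) (.plus A B)))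
  | plusE {Δ Ξ Ξ' t c d A B C} :
      Derivable (.ent Δ (A :: Ξ) (.tm c C)) → Derivable (.ent Δ (B :: Ξ) (.tm d C)) →
      Derivable (.ent Δ Ξ' (.tm t (.plus A B))) →
      Derivable (.ent Δ (Ξ' ++ Ξ)
        (.tm (.case t (c.ren (Ren.shift 0 Ξ'.length).upL) (d.ren (Ren.shift 0 Ξ'.length).upL)) C))
  | plusC1 {Δ Ξ a c d C} :
      Derivable (.ent Δ Ξ (.tm (.case (.inl a) c d) C)) →
      Derivable (.ent Δ Ξ (.tmEq (.case (.inl a) c d) (c.instL a) C))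
  | plusC2 {Δ Ξ b c d C} :
      Derivable (.ent Δ Ξ (.tm (.case (.inr b) c d) C)) →
      Derivable (.ent Δ Ξ (.tmEq (.case (.inr b) c d) (d.instL b) C))
  | plusU {Δ Ξ t A B} :
      Derivable (.ent Δ Ξ (.tm (.case t (.inl (.lvar 0)) (.inr (.lvar 0))) (.plus A B))) →
      Derivable (.ent Δ Ξ (.tm t (.plus A B))) →
      Derivable (.ent Δ Ξ
        (.tmEq (.case t (.inl (.lvar 0)) (.inr (.lvar 0))) t (.plus A B)))
  /- `!` -/
  | bangF {Δ A} : Derivable (.ent Δ [] (.ty A)) → Derivable (.ent Δ [] (.ty (.bang A)))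
  | bangI {Δ a A} :
      Derivable (.ent Δ [] (.tm a A)) → Derivable (.ent Δ [] (.tm (.bang a) (.bang A)))
  | bangE {Δ Ξ Ξ' t b A B} :
      Derivable (.ctx Δ Ξ') → Derivable (.ent Δ [] (.ty B)) →
      Derivable (.ent Δ Ξ (.tm t (.bang A))) →
      Derivable (.ent (A :: Δ) (wkCtx Ξ') (.tm b B.wk)) →
      Derivable (.ent Δ (Ξ' ++ Ξ) (.tm (.letbang (t.wkL Ξ'.length) b) B))
  | bangC {Δ Ξ a b B} :
      Derivable (.ent Δ Ξ (.tm (.letbang (.bang a) b) B)) →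
      Derivable (.ent Δ Ξ (.tmEq (.letbang (.bang a) b) (b.instI a) B))
  | bangU {Δ Ξ t A} :
      Derivable (.ent Δ Ξ (.tm (.letbang t (.bang (.ivar 0))) (.bang A))) →
      Derivable (.ent Δ Ξ (.tm t (.bang A))) →
      Derivable (.ent Δ Ξ (.tmEq (.letbang t (.bang (.ivar 0))) t (.bang A)))
  /- Commuting conversions; `C` binds no free variable of the term in front of it, since that term
  occurs below `C` only after weakening by the binders of `C` -/
  /-- `C[let a be b in c] ≡ let a be b in C[c]` -/
  | commLet {Δ Ξ D c} (C : PCtx) (L : Frame) :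
      L.IsLet →
      Derivable (.ent Δ Ξ (.tm (C.plug ((L.ren (Ren.shift C.bindI C.bindL)).plug c)) D)) →
      Derivable (.ent Δ Ξ (.tm (L.plug ((C.ren (Ren.shift L.bindI L.bindL)).plug
        (c.ren (C.exch L.bindI L.bindL)))) D)) →
      Derivable (.ent Δ Ξ (.tmEq (C.plug ((L.ren (Ren.shift C.bindI C.bindL)).plug c))
        (L.plug ((C.ren (Ren.shift L.bindI L.bindL)).plug
          (c.ren (C.exch L.bindI L.bindL)))) D))
  /-- `C[false(t)] ≡ false(t)` -/
  | commAbort {Δ Ξ Ξ' D t t'} (C : PCtx) :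
      t' = t.wkL Ξ'.length →
      Derivable (.ent Δ Ξ (.tm t .zero)) →
      Derivable (.ent Δ (Ξ' ++ Ξ)
        (.tm (C.plug (.abort (t'.ren (Ren.shift C.bindI C.bindL)))) D)) →
      Derivable (.ent Δ (Ξ' ++ Ξ)
        (.tmEq (C.plug (.abort (t'.ren (Ren.shift C.bindI C.bindL)))) (.abort t') D))
  /-- `C[case t of inl(x) → c || inr(y) → d] ≡ case t of inl(x) → C[c] || inr(y) → C[d]` -/
  | commCase {Δ Ξ Ξ' A B D t c d} (C : PCtx) :
      Derivable (.ent Δ Ξ' (.tm t (.plus A B))) →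
      Derivable (.ent Δ (Ξ' ++ Ξ)
        (.tm (C.plug (.case (t.ren (Ren.shift C.bindI C.bindL)) c d)) D)) →
      Derivable (.ent Δ (Ξ' ++ Ξ)
        (.tm (.case t ((C.ren (Ren.shift 0 1)).plug (c.ren (C.exch 0 1)))
          ((C.ren (Ren.shift 0 1)).plug (d.ren (C.exch 0 1)))) D)) →
      Derivable (.ent Δ (Ξ' ++ Ξ)
        (.tmEq (C.plug (.case (t.ren (Ren.shift C.bindI C.bindL)) c d))
          (.case t ((C.ren (Ren.shift 0 1)).plug (c.ren (C.exch 0 1)))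
            ((C.ren (Ren.shift 0 1)).plug (d.ren (C.exch 0 1)))) D))
  /- Type formers respect judgemental equality -/
  | sigCong {Δ A A' B B'} :
      Derivable (.ent Δ [] (.tyEq A A')) → Derivable (.ent (A :: Δ) [] (.tyEq B B')) →
      Derivable (.ent Δ [] (.tyEq (.sig A B) (.sig A' B')))
  | piCong {Δ A A' B B'} :
      Derivable (.ent Δ [] (.tyEq A A')) → Derivable (.ent (A :: Δ) [] (.tyEq B B')) →
      Derivable (.ent Δ [] (.tyEq (.pi A B) (.pi A' B')))
  | idCong {Δ A A' a₁ a₂ a₁' a₂'} :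
      Derivable (.ent Δ [] (.tyEq A A')) →
      Derivable (.ent Δ [] (.tmEq a₁ a₂ A)) → Derivable (.ent Δ [] (.tmEq a₁' a₂' A)) →
      Derivable (.ent Δ [] (.tyEq (.idt A a₁ a₁') (.idt A' a₂ a₂')))
  | tensorCong {Δ A A' B B'} :
      Derivable (.ent Δ [] (.tyEq A A')) → Derivable (.ent Δ [] (.tyEq B B')) →
      Derivable (.ent Δ [] (.tyEq (.tensor A B) (.tensor A' B')))
  | lolliCong {Δ A A' B B'} :
      Derivable (.ent Δ [] (.tyEq A A')) → Derivable (.ent Δ [] (.tyEq B B')) →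
      Derivable (.ent Δ [] (.tyEq (.lolli A B) (.lolli A' B')))
  | andCong {Δ A A' B B'} :
      Derivable (.ent Δ [] (.tyEq A A')) → Derivable (.ent Δ [] (.tyEq B B')) →
      Derivable (.ent Δ [] (.tyEq (.and A B) (.and A' B')))
  | plusCong {Δ A A' B B'} :
      Derivable (.ent Δ [] (.tyEq A A')) → Derivable (.ent Δ [] (.tyEq B B')) →
      Derivable (.ent Δ [] (.tyEq (.plus A B) (.plus A' B')))
  | bangCong {Δ A A'} :
      Derivable (.ent Δ [] (.tyEq A A')) →
      Derivable (.ent Δ [] (.tyEq (.bang A) (.bang A')))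
  /- Term formers respect judgemental equality -/
  | spairCong {Δ Ξ A B a₁ a₂ b₁ b₂} :
      Derivable (.ent (A :: Δ) [] (.ty B)) →
      Derivable (.ent Δ [] (.tmEq a₁ a₂ A)) →
      Derivable (.ent Δ Ξ (.tmEq b₁ b₂ (B.instI a₁))) →
      Derivable (.ent Δ Ξ (.tmEq (.spair a₁ b₁) (.spair a₂ b₂) (.sig A B)))
  | sletCong {Δ Ξ Ξ' A B C t₁ t₂ c₁ c₂} :
      Derivable (.ctx Δ Ξ') → Derivable (.ent Δ [] (.ty C)) →
      Derivable (.ent Δ Ξ (.tmEq t₁ t₂ (.sig A B))) →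
      Derivable (.ent (A :: Δ) (B :: wkCtx Ξ') (.tmEq c₁ c₂ C.wk)) →
      Derivable (.ent Δ (Ξ' ++ Ξ)
        (.tmEq (.slet (t₁.wkL Ξ'.length) c₁) (.slet (t₂.wkL Ξ'.length) c₂) C))
  | ilamCong {Δ Ξ A A' B b₁ b₂} :
      Derivable (.ctx Δ Ξ) → Derivable (.ent Δ [] (.tyEq A A')) →
      Derivable (.ent (A :: Δ) (wkCtx Ξ) (.tmEq b₁ b₂ B)) →
      Derivable (.ent Δ Ξ (.tmEq (.ilam A b₁) (.ilam A' b₂) (.pi A B)))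
  | iappCong {Δ Ξ A B f₁ f₂ a₁ a₂} :
      Derivable (.ent Δ [] (.tmEq a₁ a₂ A)) → Derivable (.ent Δ Ξ (.tmEq f₁ f₂ (.pi A B))) →
      Derivable (.ent Δ Ξ (.tmEq (.iapp f₁ a₁) (.iapp f₂ a₂) (B.instI a₁)))
  | reflCong {Δ A a₁ a₂} :
      Derivable (.ent Δ [] (.tmEq a₁ a₂ A)) →
      Derivable (.ent Δ [] (.tmEq (.refl a₁) (.refl a₂) (.idt A a₁ a₁)))
  | idletCong {Δ Ξ Ξ' A D d₁ d₂ a₁ a₂ a₁' a₂' p₁ p₂} :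
      Derivable (.ent (A.wk :: A :: Δ) [] (.ty D)) →
      Derivable (.ent (A :: Δ) Ξ (.tmEq d₁ d₂ (D.instI (.ivar 0)))) →
      Derivable (.ent Δ [] (.tmEq a₁ a₂ A)) → Derivable (.ent Δ [] (.tmEq a₁' a₂' A)) →
      Derivable (.ent Δ Ξ' (.tmEq p₁ p₂ (.idt A a₁ a₁'))) →
      Derivable (.ent Δ (Ξ' ++ Ξ.map (fun B => B.instI a₁))
        (.tmEq (.idlet a₁ a₁' p₁ (d₁.wkL Ξ'.length)) (.idlet a₂ a₂' p₂ (d₂.wkL Ξ'.length))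
          (D.subst ((Sub.id.consI a₁).consI a₁'))))
  | letstarCong {Δ Ξ Ξ' t₁ t₂ a₁ a₂ A} :
      Derivable (.ent Δ Ξ' (.tmEq t₁ t₂ .unit)) → Derivable (.ent Δ Ξ (.tmEq a₁ a₂ A)) →
      Derivable (.ent Δ (Ξ' ++ Ξ)
        (.tmEq (.letstar t₁ (a₁.wkL Ξ'.length)) (.letstar t₂ (a₂.wkL Ξ'.length)) A))
  | tpairCong {Δ Ξ Ξ' a₁ a₂ b₁ b₂ A B} :
      Derivable (.ent Δ Ξ (.tmEq a₁ a₂ A)) → Derivable (.ent Δ Ξ' (.tmEq b₁ b₂ B)) →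
      Derivable (.ent Δ (Ξ' ++ Ξ)
        (.tmEq (.tpair (a₁.wkL Ξ'.length) b₁) (.tpair (a₂.wkL Ξ'.length) b₂) (.tensor A B)))
  | tletCong {Δ Ξ Ξ' t₁ t₂ c₁ c₂ A B C} :
      Derivable (.ent Δ Ξ (.tmEq t₁ t₂ (.tensor A B))) →
      Derivable (.ent Δ (B :: A :: Ξ') (.tmEq c₁ c₂ C)) →
      Derivable (.ent Δ (Ξ' ++ Ξ)
        (.tmEq (.tlet (t₁.wkL Ξ'.length) c₁) (.tlet (t₂.wkL Ξ'.length) c₂) C))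
  | llamCong {Δ Ξ A A' B b₁ b₂} :
      Derivable (.ent Δ [] (.tyEq A A')) → Derivable (.ent Δ (A :: Ξ) (.tmEq b₁ b₂ B)) →
      Derivable (.ent Δ Ξ (.tmEq (.llam A b₁) (.llam A' b₂) (.lolli A B)))
  | lappCong {Δ Ξ Ξ' f₁ f₂ a₁ a₂ A B} :
      Derivable (.ent Δ Ξ (.tmEq f₁ f₂ (.lolli A B))) →
      Derivable (.ent Δ Ξ' (.tmEq a₁ a₂ A)) →
      Derivable (.ent Δ (Ξ' ++ Ξ)
        (.tmEq (.lapp (f₁.wkL Ξ'.length) a₁) (.lapp (f₂.wkL Ξ'.length) a₂) B))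
  | pairCong {Δ Ξ a₁ a₂ b₁ b₂ A B} :
      Derivable (.ent Δ Ξ (.tmEq a₁ a₂ A)) → Derivable (.ent Δ Ξ (.tmEq b₁ b₂ B)) →
      Derivable (.ent Δ Ξ (.tmEq (.pair a₁ b₁) (.pair a₂ b₂) (.and A B)))
  | fstCong {Δ Ξ t₁ t₂ A B} :
      Derivable (.ent Δ Ξ (.tmEq t₁ t₂ (.and A B))) →
      Derivable (.ent Δ Ξ (.tmEq (.fst t₁) (.fst t₂) A))
  | sndCong {Δ Ξ t₁ t₂ A B} :
      Derivable (.ent Δ Ξ (.tmEq t₁ t₂ (.and A B))) →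
      Derivable (.ent Δ Ξ (.tmEq (.snd t₁) (.snd t₂) B))
  | abortCong {Δ Ξ Ξ' t₁ t₂ B} :
      Derivable (.ctx Δ Ξ') → Derivable (.ent Δ [] (.ty B)) →
      Derivable (.ent Δ Ξ (.tmEq t₁ t₂ .zero)) →
      Derivable (.ent Δ (Ξ' ++ Ξ)
        (.tmEq (.abort (t₁.wkL Ξ'.length)) (.abort (t₂.wkL Ξ'.length)) B))
  | inlCong {Δ Ξ a₁ a₂ A B} :
      Derivable (.ent Δ [] (.ty B)) → Derivable (.ent Δ Ξ (.tmEq a₁ a₂ A)) →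
      Derivable (.ent Δ Ξ (.tmEq (.inl a₁) (.inl a₂) (.plus A B)))
  | inrCong {Δ Ξ b₁ b₂ A B} :
      Derivable (.ent Δ [] (.ty A)) → Derivable (.ent Δ Ξ (.tmEq b₁ b₂ B)) →
      Derivable (.ent Δ Ξ (.tmEq (.inr b₁) (.inr b₂) (.plus A B)))
  | caseCong {Δ Ξ Ξ' t₁ t₂ c₁ c₂ d₁ d₂ A B C} :
      Derivable (.ent Δ (A :: Ξ) (.tmEq c₁ c₂ C)) → Derivable (.ent Δ (B :: Ξ) (.tmEq d₁ d₂ C)) →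
      Derivable (.ent Δ Ξ' (.tmEq t₁ t₂ (.plus A B))) →
      Derivable (.ent Δ (Ξ' ++ Ξ) (.tmEq
        (.case t₁ (c₁.ren (Ren.shift 0 Ξ'.length).upL) (d₁.ren (Ren.shift 0 Ξ'.length).upL))
        (.case t₂ (c₂.ren (Ren.shift 0 Ξ'.length).upL) (d₂.ren (Ren.shift 0 Ξ'.length).upL)) C))
  | bangTmCong {Δ a₁ a₂ A} :
      Derivable (.ent Δ [] (.tmEq a₁ a₂ A)) →
      Derivable (.ent Δ [] (.tmEq (.bang a₁) (.bang a₂) (.bang A)))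
  | letbangCong {Δ Ξ Ξ' t₁ t₂ b₁ b₂ A B} :
      Derivable (.ctx Δ Ξ') → Derivable (.ent Δ [] (.ty B)) →
      Derivable (.ent Δ Ξ (.tmEq t₁ t₂ (.bang A))) →
      Derivable (.ent (A :: Δ) (wkCtx Ξ') (.tmEq b₁ b₂ B.wk)) →
      Derivable (.ent Δ (Ξ' ++ Ξ)
        (.tmEq (.letbang (t₁.wkL Ξ'.length) b₁) (.letbang (t₂.wkL Ξ'.length) b₂) B))

/-! ### Consistency -/

/-- Consistency as a type theory: it is not the case that any two terms of the same type in the same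
context are judgementally equal. -/
def ConsistentAsTypeTheory : Prop :=
  ¬ ∀ (Δ Ξ : List Ty) (A : Ty) (a a' : Tm),
    Derivable (.ent Δ Ξ (.tm a A)) → Derivable (.ent Δ Ξ (.tm a' A)) →
      Derivable (.ent Δ Ξ (.tmEq a a' A))

/-- Consistency as a logic: it is not the case that every closed type has a closed term. -/
def ConsistentAsLogic : Prop :=
  ¬ ∀ A : Ty, Derivable (.ent [] [] (.ty A)) → ∃ a : Tm, Derivable (.ent [] [] (.tm a A))

end ILDTT

-- Consistency follows from soundness of a set-theoretic model that forgets linearity. A type over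
-- an environment denotes a set and a term denotes a value: `Σ`, `⊗` and `&` are sets of pairs, `Π`
-- and `⊸` are sets of function graphs, `⊕` is a disjoint union, `Id` has at most one element, `0`
-- is empty, `I` and `⊤` are singletons, and `!` is the identity. The model also validates weakening
-- and contraction of linear variables, which does no harm. In it `inl(*)` and `inr(*)` are
-- different elements of `I ⊕ I`, and `0` has no element, which gives the two claims.
--
-- The work lies in `Derivable.valid`, an induction on derivations. Interpretation is a total
-- function on raw syntax, so the renaming and substitution lemmas (`Ty.eval_subst`,
-- `Tm.eval_subst`) need no typing, and most computation rules and all `let` conversions are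
-- identities between values of raw terms. Two devices replace the inversion of typing rules.
--
-- First, the computation rules for functions assume only that the redex is typed. The value `∅` is
-- kept out of every type (`Ty.empty_notMem`) and is the result of applying a graph outside its
-- domain; a redex with a value in some type therefore has its argument in the domain.
--
-- Second, elimination rules such as the one for `fst` do not assume that the resulting type is well
-- formed, and a set such as an empty product does not determine its factors. Types therefore denote
-- codes, which are injective for `Π`, `⊸` and `&`, and the set of elements is read off the code.
--
-- Raw types and terms may mention arbitrary linear variables, so validity compares values at two
-- linear environments: types must not depend on them at all, and terms only through the region `Ξ`.
-- This makes validity of equations a partial equivalence relation. Validity of a judgement also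
-- includes its presuppositions, so the induction hypotheses supply the well-formedness facts that
-- the rules omit.

namespace ILDTT

noncomputable section

/-! ### Set-theoretic operations -/

/-- The replacement of `X` along an arbitrary function. -/
def imageOf (F : ZFSet.{0} → ZFSet.{0}) (X : ZFSet.{0}) : ZFSet.{0} :=
  letI := @Classical.allZFSetDefinable
  ZFSet.image F X

theorem mem_imageOf {F : ZFSet → ZFSet} {X y : ZFSet} : y ∈ imageOf F X ↔ ∃ x ∈ X, F x = y :=
  @ZFSet.mem_image F (@Classical.allZFSetDefinable _ _) X y

/-- The set of pairs `(x, y)` with `x ∈ X` and `y ∈ F x`. -/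
def depSum (X : ZFSet) (F : ZFSet → ZFSet) : ZFSet :=
  ZFSet.sUnion (imageOf (fun x => imageOf (ZFSet.pair x) (F x)) X)

theorem mem_depSum {X z : ZFSet} {F : ZFSet → ZFSet} :
    z ∈ depSum X F ↔ ∃ x ∈ X, ∃ y ∈ F x, z = ZFSet.pair x y := by
  simp only [depSum, ZFSet.mem_sUnion, mem_imageOf]
  constructor
  · rintro ⟨_, ⟨x, hx, rfl⟩, hz⟩
    obtain ⟨y, hy, rfl⟩ := mem_imageOf.1 hz
    exact ⟨x, hx, y, hy, rfl⟩
  · rintro ⟨x, hx, y, hy, rfl⟩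
    exact ⟨_, ⟨x, hx, rfl⟩, mem_imageOf.2 ⟨y, hy, rfl⟩⟩

/-- The graph of `F` on `X`, with `∅` adjoined so that it is never empty. -/
def lam (X : ZFSet) (F : ZFSet → ZFSet) : ZFSet :=
  insert ∅ (imageOf (fun x => ZFSet.pair x (F x)) X)

theorem pair_ne_empty (x y : ZFSet) : ZFSet.pair x y ≠ ∅ := by
  intro h
  have : ({x} : ZFSet) ∈ ZFSet.pair x y := by simp [ZFSet.pair]
  rw [h] at this
  exact ZFSet.notMem_empty _ this

theorem lam_ne_empty (X : ZFSet) (F : ZFSet → ZFSet) : lam X F ≠ ∅ := by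
  intro h
  have : (∅ : ZFSet) ∈ lam X F := by simp [lam]
  rw [h] at this
  exact ZFSet.notMem_empty _ this

/-- A Kuratowski pair is nonempty, so the adjoined `∅` cannot be mistaken for an entry of the graph.
-/
theorem pair_mem_lam {X x y : ZFSet} {F : ZFSet → ZFSet} :
    ZFSet.pair x y ∈ lam X F ↔ x ∈ X ∧ y = F x := by
  simp only [lam, ZFSet.mem_insert_iff, pair_ne_empty, false_or, mem_imageOf, ZFSet.pair_inj]
  constructor
  · rintro ⟨_, h, rfl, rfl⟩
    exact ⟨h, rfl⟩
  · rintro ⟨h, rfl⟩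
    exact ⟨x, h, rfl, rfl⟩

theorem lam_congr {X Y : ZFSet} {F G : ZFSet → ZFSet} (h : X = Y) (hF : ∀ x ∈ X, F x = G x) :
    lam X F = lam Y G := by
  subst h
  unfold lam
  congr 1
  ext z
  simp only [mem_imageOf]
  exact exists_congr fun x => and_congr_right fun hx => by rw [hF x hx]

open Classical in
/-- Application of a graph, with value `∅` outside its domain. -/
def app (f x : ZFSet.{0}) : ZFSet.{0} := if h : ∃ y, ZFSet.pair x y ∈ f then h.choose else ∅

theorem app_lam {X x : ZFSet} {F : ZFSet → ZFSet} (hx : x ∈ X) : app (lam X F) x = F x := by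
  have h : ∃ y, ZFSet.pair x y ∈ lam X F := ⟨F x, pair_mem_lam.2 ⟨hx, rfl⟩⟩
  rw [app, dif_pos h]
  exact (pair_mem_lam.1 h.choose_spec).2

/-- The default value `∅` exposes a badly typed argument, because no type contains it; the β-rules
for functions rest on this. -/
theorem app_lam_of_notMem {X x : ZFSet} {F : ZFSet → ZFSet} (hx : x ∉ X) :
    app (lam X F) x = ∅ :=
  dif_neg fun ⟨_, hy⟩ => hx (pair_mem_lam.1 hy).1

/-- The set of graphs of functions `G` on `X` with `G x ∈ F x`. -/
def depProd (X : ZFSet) (F : ZFSet → ZFSet) : ZFSet :=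
  ZFSet.sep (fun f => ∃ G : ZFSet → ZFSet, (∀ x ∈ X, G x ∈ F x) ∧ f = lam X G)
    (ZFSet.powerset (insert ∅ (depSum X F)))

theorem mem_depProd {X f : ZFSet} {F : ZFSet → ZFSet} :
    f ∈ depProd X F ↔ ∃ G : ZFSet → ZFSet, (∀ x ∈ X, G x ∈ F x) ∧ f = lam X G := by
  simp only [depProd, ZFSet.mem_sep, ZFSet.mem_powerset, and_iff_right_iff_imp]
  rintro ⟨G, hG, rfl⟩ z hz
  simp only [lam, ZFSet.mem_insert_iff, mem_imageOf] at hz ⊢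
  refine hz.imp id ?_
  rintro ⟨x, hx, rfl⟩
  exact mem_depSum.2 ⟨x, hx, _, hG x hx, rfl⟩

theorem lam_mem_depProd {X : ZFSet} {F G : ZFSet → ZFSet} (h : ∀ x ∈ X, G x ∈ F x) :
    lam X G ∈ depProd X F :=
  mem_depProd.2 ⟨G, h, rfl⟩

theorem app_mem {X f x : ZFSet} {F : ZFSet → ZFSet} (hf : f ∈ depProd X F) (hx : x ∈ X) :
    app f x ∈ F x := by
  obtain ⟨G, hG, rfl⟩ := mem_depProd.1 hf
  rw [app_lam hx]
  exact hG x hx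

/-- Semantic η-rule for both kinds of function type. -/
theorem lam_app {X f : ZFSet} {F : ZFSet → ZFSet} (hf : f ∈ depProd X F) : lam X (app f) = f := by
  obtain ⟨G, hG, rfl⟩ := mem_depProd.1 hf
  exact lam_congr rfl fun x hx => app_lam hx

open Classical in
/-- First projection, with value `∅` outside pairs. -/
def pfst (p : ZFSet.{0}) : ZFSet.{0} := if h : ∃ x y, ZFSet.pair x y = p then h.choose else ∅

open Classical in
/-- Second projection, with value `∅` outside pairs. -/
def psnd (p : ZFSet.{0}) : ZFSet.{0} := if h : ∃ y x, ZFSet.pair x y = p then h.choose else ∅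

@[simp] theorem pfst_pair (x y : ZFSet) : pfst (ZFSet.pair x y) = x := by
  have h : ∃ x' y', ZFSet.pair x' y' = ZFSet.pair x y := ⟨x, y, rfl⟩
  rw [pfst, dif_pos h]
  obtain ⟨_, h'⟩ := h.choose_spec
  exact (ZFSet.pair_inj.1 h').1

@[simp] theorem psnd_pair (x y : ZFSet) : psnd (ZFSet.pair x y) = y := by
  have h : ∃ y' x', ZFSet.pair x' y' = ZFSet.pair x y := ⟨y, x, rfl⟩
  rw [psnd, dif_pos h]
  obtain ⟨_, h'⟩ := h.choose_spec
  exact (ZFSet.pair_inj.1 h').2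

theorem pair_mem_depSum {X x y : ZFSet} {F : ZFSet → ZFSet} (hx : x ∈ X) (hy : y ∈ F x) :
    ZFSet.pair x y ∈ depSum X F :=
  mem_depSum.2 ⟨x, hx, y, hy, rfl⟩

theorem depSum_elim {X z : ZFSet} {F : ZFSet → ZFSet} (h : z ∈ depSum X F) :
    pfst z ∈ X ∧ psnd z ∈ F (pfst z) ∧ ZFSet.pair (pfst z) (psnd z) = z := by
  obtain ⟨x, hx, y, hy, rfl⟩ := mem_depSum.1 h
  simp [hx, hy]

theorem depSum_congr {X Y : ZFSet} {F G : ZFSet → ZFSet} (h : X = Y) (hF : ∀ x ∈ X, F x = G x) :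
    depSum X F = depSum Y G := by
  subst h
  ext z
  simp only [mem_depSum]
  exact exists_congr fun x => and_congr_right fun hx => by rw [hF x hx]

/-- Left injection into a disjoint union. -/
def injl (x : ZFSet.{0}) : ZFSet.{0} := ZFSet.pair ∅ x

/-- Right injection into a disjoint union. -/
def injr (x : ZFSet.{0}) : ZFSet.{0} := ZFSet.pair {∅} x

/-- Disjoint union. -/
def disjSum (X Y : ZFSet.{0}) : ZFSet.{0} := imageOf injl X ∪ imageOf injr Y

theorem singleton_empty_ne : ({∅} : ZFSet) ≠ ∅ := by
  intro h
  have : (∅ : ZFSet) ∈ ({∅} : ZFSet) := ZFSet.mem_singleton.2 rfl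
  rw [h] at this
  exact ZFSet.notMem_empty _ this

theorem mem_disjSum {X Y z : ZFSet} :
    z ∈ disjSum X Y ↔ (∃ x ∈ X, injl x = z) ∨ ∃ y ∈ Y, injr y = z := by
  simp only [disjSum, ZFSet.mem_union, mem_imageOf]

open Classical in
/-- Case distinction on a disjoint union. -/
def caseOf (t : ZFSet.{0}) (f g : ZFSet.{0} → ZFSet.{0}) : ZFSet.{0} :=
  if pfst t = ∅ then f (psnd t) else g (psnd t)

@[simp] theorem caseOf_injl (x : ZFSet) (f g : ZFSet → ZFSet) : caseOf (injl x) f g = f x := by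
  simp [caseOf, injl]

@[simp] theorem caseOf_injr (x : ZFSet) (f g : ZFSet → ZFSet) : caseOf (injr x) f g = g x := by
  simp [caseOf, injr, singleton_empty_ne]

/-! ### Codes of types -/

/-- Codes of types. Those type formers whose constituents must be recovered from the type have a
constructor of their own. -/
inductive Code : Type 1 where
  | base (X : ZFSet.{0})
  | pi (A : Code) (B : ZFSet.{0} → Code)
  | lolli (A B : Code)
  | and (A B : Code)

/-- The set of elements of a code. -/
def Code.El : Code → ZFSet
  | .base X => X
  | .pi A B => depProd A.El fun x => (B x).El
  | .lolli A B => depProd A.El fun _ => B.El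
  | .and A B => depSum A.El fun _ => B.El

open Classical in
/-- Code of a dependent product; the family matters only on the elements of `A`. -/
def Code.piOn (A : Code) (B : ZFSet.{0} → Code) : Code :=
  -- Outside the domain the family is normalised to a fixed code, so that families agreeing on the
  -- domain give equal codes.
  .pi A fun x => if x ∈ A.El then B x else .base ∅

theorem Code.piOn_congr {A A' : Code} {B B' : ZFSet → Code} (h : A = A')
    (hB : ∀ x ∈ A.El, B x = B' x) : A.piOn B = A'.piOn B' := by
  subst h
  unfold Code.piOn
  congr 1
  funext x
  split_ifs with hx
  exacts [hB x hx, rfl]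

/-- For sets of functions this fails, since a product with one empty fibre is empty; it is the
reason for working with codes. -/
theorem Code.piOn_inj {A A' : Code} {B B' : ZFSet → Code} (h : A.piOn B = A'.piOn B') :
    A = A' ∧ ∀ x ∈ A.El, B x = B' x := by
  simp only [Code.piOn, Code.pi.injEq] at h
  obtain ⟨rfl, h⟩ := h
  refine ⟨rfl, fun x hx => ?_⟩
  have := congrFun h x
  simpa [hx] using this

theorem Code.El_piOn (A : Code) (B : ZFSet → Code) :
    (A.piOn B).El = depProd A.El fun x => (B x).El := by
  ext f
  simp only [Code.piOn, Code.El, mem_depProd]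
  refine exists_congr fun G => and_congr_left fun _ => forall₂_congr fun x hx => ?_
  rw [if_pos hx]

/-! ### Environments -/

/-- Environments for one region. -/
abbrev Env := ℕ → ZFSet.{0}

/-- Extension of an environment by a value for a new variable `0`. -/
def scons {α : Type*} (x : α) (f : ℕ → α) : ℕ → α
  | 0 => x
  | n + 1 => f n

/-- Forgetting the last `k` variables. -/
def drop {α : Type*} (k : ℕ) (f : ℕ → α) : ℕ → α := fun n => f (n + k)

@[simp] theorem scons_zero {α : Type*} (x : α) (f : ℕ → α) : scons x f 0 = x := rfl

@[simp] theorem drop_one_scons {α : Type*} (x : α) (f : ℕ → α) : drop 1 (scons x f) = f := rfl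

theorem drop_drop {α : Type*} (j k : ℕ) (f : ℕ → α) : drop j (drop k f) = drop (j + k) f := by
  funext n
  simp [drop, Nat.add_assoc]

theorem scons_drop_one {α : Type*} (f : ℕ → α) : scons (f 0) (drop 1 f) = f := by
  funext n
  cases n <;> rfl

/-- The empty linear environment. -/
def nilEnv : Env := fun _ => ∅

/-! ### Interpretation -/

/-- The unique value of `I`, `⊤` and inhabited identity types. -/
def pt : ZFSet.{0} := {∅}

theorem pt_ne_empty : pt ≠ ∅ := singleton_empty_ne

open Classical in
/-- The set with element `pt` if `x = y`, and empty otherwise. -/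
def idSet (x y : ZFSet.{0}) : ZFSet.{0} := if x = y then {pt} else ∅

theorem mem_idSet {x y z : ZFSet} : z ∈ idSet x y ↔ x = y ∧ z = pt := by
  unfold idSet
  split_ifs with h <;> simp [h]

mutual
/-- Interpretation of raw types. -/
def Ty.eval : Ty → Env → Env → Code
  | .sig A B, i, l => .base (depSum (A.eval i l).El fun x => (B.eval (scons x i) l).El)
  | .pi A B, i, l => (A.eval i l).piOn fun x => B.eval (scons x i) l
  -- The underlying type plays no role: equality is that of the ambient universe of sets.
  | .idt _ a a', i, l => .base (idSet (a.eval i l) (a'.eval i l))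
  | .unit, _, _ => .base {pt}
  | .tensor A B, i, l => .base (depSum (A.eval i l).El fun _ => (B.eval i l).El)
  | .lolli A B, i, l => .lolli (A.eval i l) (B.eval i l)
  | .top, _, _ => .base {pt}
  | .and A B, i, l => .and (A.eval i l) (B.eval i l)
  | .zero, _, _ => .base ∅
  | .plus A B, i, l => .base (disjSum (A.eval i l).El (B.eval i l).El)
  -- The model is cartesian, so the exponential can be the identity.
  | .bang A, i, l => A.eval i l

/-- Interpretation of raw terms. -/
def Tm.eval : Tm → Env → Env → ZFSet.{0}
  | .ivar n, i, _ => i n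
  | .lvar n, _, l => l n
  | .spair a b, i, l => ZFSet.pair (a.eval i l) (b.eval i l)
  | .slet t c, i, l => c.eval (scons (pfst (t.eval i l)) i) (scons (psnd (t.eval i l)) l)
  | .ilam A b, i, l => lam (A.eval i l).El fun x => b.eval (scons x i) l
  | .iapp f a, i, l => app (f.eval i l) (a.eval i l)
  | .refl _, _, _ => pt
  -- Only the first endpoint is used: an element of the identity type forces both endpoints to
  -- coincide and the proof to be `pt`.
  | .idlet a _ _ d, i, l => d.eval (scons (a.eval i l) i) l
  | .star, _, _ => pt
  | .letstar _ a, i, l => a.eval i l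
  | .tpair a b, i, l => ZFSet.pair (a.eval i l) (b.eval i l)
  | .tlet t c, i, l => c.eval i (scons (psnd (t.eval i l)) (scons (pfst (t.eval i l)) l))
  | .llam A b, i, l => lam (A.eval i l).El fun x => b.eval i (scons x l)
  | .lapp f a, i, l => app (f.eval i l) (a.eval i l)
  | .nil, _, _ => pt
  | .pair a b, i, l => ZFSet.pair (a.eval i l) (b.eval i l)
  | .fst t, i, l => pfst (t.eval i l)
  | .snd t, i, l => psnd (t.eval i l)
  -- A junk value outside all types; validity never sees it, as a term of `0` is valid only over a
  -- region without satisfying environments.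
  | .abort _, _, _ => ∅
  | .inl a, i, l => injl (a.eval i l)
  | .inr b, i, l => injr (b.eval i l)
  | .case t c d, i, l => caseOf (t.eval i l) (fun x => c.eval i (scons x l))
      fun x => d.eval i (scons x l)
  | .bang a, i, l => a.eval i l
  | .letbang t b, i, l => b.eval (scons (t.eval i l) i) l
end

/-- The value `∅` is not an element of any type. -/
theorem Ty.empty_notMem : ∀ (A : Ty) (i l : Env), (∅ : ZFSet) ∉ (A.eval i l).El
  | .sig A B, i, l => fun h => by
    obtain ⟨x, _, y, _, h⟩ := mem_depSum.1 h
    exact pair_ne_empty _ _ h.symm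
  | .pi A B, i, l => fun h => by
    rw [Ty.eval, Code.El_piOn] at h
    obtain ⟨G, _, h⟩ := mem_depProd.1 h
    exact lam_ne_empty _ _ h.symm
  | .idt _ a a', i, l => fun h => by
    exact pt_ne_empty (mem_idSet.1 h).2.symm
  | .unit, i, l => fun h => pt_ne_empty (ZFSet.mem_singleton.1 h).symm
  | .tensor A B, i, l => fun h => by
    obtain ⟨x, _, y, _, h⟩ := mem_depSum.1 h
    exact pair_ne_empty _ _ h.symm
  | .lolli A B, i, l => fun h => by
    obtain ⟨G, _, h⟩ := mem_depProd.1 h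
    exact lam_ne_empty _ _ h.symm
  | .top, i, l => fun h => pt_ne_empty (ZFSet.mem_singleton.1 h).symm
  | .and A B, i, l => fun h => by
    obtain ⟨x, _, y, _, h⟩ := mem_depSum.1 h
    exact pair_ne_empty _ _ h.symm
  | .zero, i, l => ZFSet.notMem_empty _
  | .plus A B, i, l => fun h => by
    rcases mem_disjSum.1 h with ⟨x, _, h⟩ | ⟨x, _, h⟩
    · exact pair_ne_empty _ _ h
    · exact pair_ne_empty _ _ h
  | .bang A, i, l => A.empty_notMem i l

/-! ### Renaming and substitution in the model -/

/-- Lifting a renaming under a binder corresponds to leaving the new value alone; this settles all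
binder cases below. -/
theorem scons_comp_liftIdx {α : Type*} (x : α) (f : ℕ → α) (g : ℕ → ℕ) :
    (fun n => scons x f (liftIdx g n)) = scons x fun n => f (g n) := by
  funext n
  cases n <;> rfl

-- Since evaluation is total, structural induction on raw syntax suffices, with no typing
-- hypotheses. Types and terms go together because identity types contain terms and abstractions
-- contain types.
mutual
theorem Ty.eval_ren : ∀ (A : Ty) (r : Ren) (i l : Env),
    (A.ren r).eval i l = A.eval (fun n => i (r.i n)) fun n => l (r.l n)
  | .sig A B, r, i, l => by
    simp only [Ty.ren, Ty.eval, A.eval_ren, B.eval_ren, Ren.upI, scons_comp_liftIdx]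
  | .pi A B, r, i, l => by
    simp only [Ty.ren, Ty.eval, A.eval_ren, B.eval_ren, Ren.upI, scons_comp_liftIdx]
  | .idt A a a', r, i, l => by simp only [Ty.ren, Ty.eval, a.eval_ren, a'.eval_ren]
  | .unit, r, i, l => rfl
  | .tensor A B, r, i, l => by simp only [Ty.ren, Ty.eval, A.eval_ren, B.eval_ren]
  | .lolli A B, r, i, l => by simp only [Ty.ren, Ty.eval, A.eval_ren, B.eval_ren]
  | .top, r, i, l => rfl
  | .and A B, r, i, l => by simp only [Ty.ren, Ty.eval, A.eval_ren, B.eval_ren]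
  | .zero, r, i, l => rfl
  | .plus A B, r, i, l => by simp only [Ty.ren, Ty.eval, A.eval_ren, B.eval_ren]
  | .bang A, r, i, l => by simp only [Ty.ren, Ty.eval, A.eval_ren]

theorem Tm.eval_ren : ∀ (a : Tm) (r : Ren) (i l : Env),
    (a.ren r).eval i l = a.eval (fun n => i (r.i n)) fun n => l (r.l n)
  | .ivar n, r, i, l => rfl
  | .lvar n, r, i, l => rfl
  | .spair a b, r, i, l => by simp only [Tm.ren, Tm.eval, a.eval_ren, b.eval_ren]
  | .slet t c, r, i, l => by
    simp only [Tm.ren, Tm.eval, t.eval_ren, c.eval_ren, Ren.upI, Ren.upL, scons_comp_liftIdx]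
  | .ilam A b, r, i, l => by
    simp only [Tm.ren, Tm.eval, A.eval_ren, b.eval_ren, Ren.upI, scons_comp_liftIdx]
  | .iapp f a, r, i, l => by simp only [Tm.ren, Tm.eval, f.eval_ren, a.eval_ren]
  | .refl a, r, i, l => rfl
  | .idlet a a' p d, r, i, l => by
    simp only [Tm.ren, Tm.eval, a.eval_ren, d.eval_ren, Ren.upI, scons_comp_liftIdx]
  | .star, r, i, l => rfl
  | .letstar t a, r, i, l => by simp only [Tm.ren, Tm.eval, a.eval_ren]
  | .tpair a b, r, i, l => by simp only [Tm.ren, Tm.eval, a.eval_ren, b.eval_ren]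
  | .tlet t c, r, i, l => by
    simp only [Tm.ren, Tm.eval, t.eval_ren, c.eval_ren, Ren.upL, scons_comp_liftIdx]
  | .llam A b, r, i, l => by
    simp only [Tm.ren, Tm.eval, A.eval_ren, b.eval_ren, Ren.upL, scons_comp_liftIdx]
  | .lapp f a, r, i, l => by simp only [Tm.ren, Tm.eval, f.eval_ren, a.eval_ren]
  | .nil, r, i, l => rfl
  | .pair a b, r, i, l => by simp only [Tm.ren, Tm.eval, a.eval_ren, b.eval_ren]
  | .fst t, r, i, l => by simp only [Tm.ren, Tm.eval, t.eval_ren]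
  | .snd t, r, i, l => by simp only [Tm.ren, Tm.eval, t.eval_ren]
  | .abort t, r, i, l => rfl
  | .inl a, r, i, l => by simp only [Tm.ren, Tm.eval, a.eval_ren]
  | .inr b, r, i, l => by simp only [Tm.ren, Tm.eval, b.eval_ren]
  | .case t c d, r, i, l => by
    simp only [Tm.ren, Tm.eval, t.eval_ren, c.eval_ren, d.eval_ren, Ren.upL, scons_comp_liftIdx]
  | .bang a, r, i, l => by simp only [Tm.ren, Tm.eval, a.eval_ren]
  | .letbang t b, r, i, l => by
    simp only [Tm.ren, Tm.eval, t.eval_ren, b.eval_ren, Ren.upI, scons_comp_liftIdx]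
end

/-- Values of the intuitionistic part of a substitution. -/
def Sub.evalI (s : Sub) (i l : Env) : Env := fun n => (s.i n).eval i l

/-- Values of the linear part of a substitution. -/
def Sub.evalL (s : Sub) (i l : Env) : Env := fun n => (s.l n).eval i l

/-- Going under a binder weakens the substituted terms, and by `Tm.eval_ren` weakened terms ignore
the new value. The three lemmas that follow treat the other combinations of regions. -/
theorem Sub.evalI_upI (s : Sub) (x : ZFSet) (i l : Env) :
    s.upI.evalI (scons x i) l = scons x (s.evalI i l) := by
  funext n
  cases n with
  | zero => rfl
  | succ n => exact Tm.eval_ren _ _ _ _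

theorem Sub.evalL_upI (s : Sub) (x : ZFSet) (i l : Env) :
    s.upI.evalL (scons x i) l = s.evalL i l := by
  funext n
  exact Tm.eval_ren _ _ _ _

theorem Sub.evalI_upL (s : Sub) (x : ZFSet) (i l : Env) :
    s.upL.evalI i (scons x l) = s.evalI i l := by
  funext n
  exact Tm.eval_ren _ _ _ _

theorem Sub.evalL_upL (s : Sub) (x : ZFSet) (i l : Env) :
    s.upL.evalL i (scons x l) = scons x (s.evalL i l) := by
  funext n
  cases n with
  | zero => rfl
  | succ n => exact Tm.eval_ren _ _ _ _

-- The substitution lemma of the model, again for raw syntax: substituting and then evaluating is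
-- evaluating in the environment of values of the substitution.
mutual
theorem Ty.eval_subst : ∀ (A : Ty) (s : Sub) (i l : Env),
    (A.subst s).eval i l = A.eval (s.evalI i l) (s.evalL i l)
  | .sig A B, s, i, l => by
    simp only [Ty.subst, Ty.eval, A.eval_subst, B.eval_subst, Sub.evalI_upI, Sub.evalL_upI]
  | .pi A B, s, i, l => by
    simp only [Ty.subst, Ty.eval, A.eval_subst, B.eval_subst, Sub.evalI_upI, Sub.evalL_upI]
  | .idt A a a', s, i, l => by simp only [Ty.subst, Ty.eval, a.eval_subst, a'.eval_subst]
  | .unit, s, i, l => rfl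
  | .tensor A B, s, i, l => by simp only [Ty.subst, Ty.eval, A.eval_subst, B.eval_subst]
  | .lolli A B, s, i, l => by simp only [Ty.subst, Ty.eval, A.eval_subst, B.eval_subst]
  | .top, s, i, l => rfl
  | .and A B, s, i, l => by simp only [Ty.subst, Ty.eval, A.eval_subst, B.eval_subst]
  | .zero, s, i, l => rfl
  | .plus A B, s, i, l => by simp only [Ty.subst, Ty.eval, A.eval_subst, B.eval_subst]
  | .bang A, s, i, l => by simp only [Ty.subst, Ty.eval, A.eval_subst]

theorem Tm.eval_subst : ∀ (a : Tm) (s : Sub) (i l : Env),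
    (a.subst s).eval i l = a.eval (s.evalI i l) (s.evalL i l)
  | .ivar n, s, i, l => rfl
  | .lvar n, s, i, l => rfl
  | .spair a b, s, i, l => by simp only [Tm.subst, Tm.eval, a.eval_subst, b.eval_subst]
  | .slet t c, s, i, l => by
    simp only [Tm.subst, Tm.eval, t.eval_subst, c.eval_subst, Sub.evalI_upI, Sub.evalL_upI,
      Sub.evalI_upL, Sub.evalL_upL]
  | .ilam A b, s, i, l => by
    simp only [Tm.subst, Tm.eval, A.eval_subst, b.eval_subst, Sub.evalI_upI, Sub.evalL_upI]
  | .iapp f a, s, i, l => by simp only [Tm.subst, Tm.eval, f.eval_subst, a.eval_subst]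
  | .refl a, s, i, l => rfl
  | .idlet a a' p d, s, i, l => by
    simp only [Tm.subst, Tm.eval, a.eval_subst, d.eval_subst, Sub.evalI_upI, Sub.evalL_upI]
  | .star, s, i, l => rfl
  | .letstar t a, s, i, l => by simp only [Tm.subst, Tm.eval, a.eval_subst]
  | .tpair a b, s, i, l => by simp only [Tm.subst, Tm.eval, a.eval_subst, b.eval_subst]
  | .tlet t c, s, i, l => by
    simp only [Tm.subst, Tm.eval, t.eval_subst, c.eval_subst, Sub.evalI_upL, Sub.evalL_upL]
  | .llam A b, s, i, l => by
    simp only [Tm.subst, Tm.eval, A.eval_subst, b.eval_subst, Sub.evalI_upL, Sub.evalL_upL]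
  | .lapp f a, s, i, l => by simp only [Tm.subst, Tm.eval, f.eval_subst, a.eval_subst]
  | .nil, s, i, l => rfl
  | .pair a b, s, i, l => by simp only [Tm.subst, Tm.eval, a.eval_subst, b.eval_subst]
  | .fst t, s, i, l => by simp only [Tm.subst, Tm.eval, t.eval_subst]
  | .snd t, s, i, l => by simp only [Tm.subst, Tm.eval, t.eval_subst]
  | .abort t, s, i, l => rfl
  | .inl a, s, i, l => by simp only [Tm.subst, Tm.eval, a.eval_subst]
  | .inr b, s, i, l => by simp only [Tm.subst, Tm.eval, b.eval_subst]
  | .case t c d, s, i, l => by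
    simp only [Tm.subst, Tm.eval, t.eval_subst, c.eval_subst, d.eval_subst, Sub.evalI_upL,
      Sub.evalL_upL]
  | .bang a, s, i, l => by simp only [Tm.subst, Tm.eval, a.eval_subst]
  | .letbang t b, s, i, l => by
    simp only [Tm.subst, Tm.eval, t.eval_subst, b.eval_subst, Sub.evalI_upI, Sub.evalL_upI]
end

-- Weakening, instantiation and cut in the model

theorem Ty.eval_wk (A : Ty) (i l : Env) : A.wk.eval i l = A.eval (drop 1 i) l := A.eval_ren _ _ _

theorem Tm.eval_wk (a : Tm) (i l : Env) : a.wk.eval i l = a.eval (drop 1 i) l := a.eval_ren _ _ _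

theorem Tm.eval_wkL (a : Tm) (k : ℕ) (i l : Env) : (a.wkL k).eval i l = a.eval i (drop k l) :=
  a.eval_ren _ _ _

theorem Sub.evalI_consI (s : Sub) (a : Tm) (i l : Env) :
    (s.consI a).evalI i l = scons (a.eval i l) (s.evalI i l) := by
  funext n
  cases n <;> rfl

theorem Sub.evalL_consL (s : Sub) (a : Tm) (i l : Env) :
    (s.consL a).evalL i l = scons (a.eval i l) (s.evalL i l) := by
  funext n
  cases n <;> rfl

theorem Sub.evalL_consI (s : Sub) (a : Tm) (i l : Env) : (s.consI a).evalL i l = s.evalL i l := rfl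

theorem Sub.evalI_consL (s : Sub) (a : Tm) (i l : Env) : (s.consL a).evalI i l = s.evalI i l := rfl

theorem Sub.evalI_id (i l : Env) : Sub.id.evalI i l = i := rfl

theorem Sub.evalL_id (i l : Env) : Sub.id.evalL i l = l := rfl

theorem Ty.eval_instI (B : Ty) (a : Tm) (i l : Env) :
    (B.instI a).eval i l = B.eval (scons (a.eval i l) i) l := by
  simp only [Ty.instI, Ty.eval_subst, Sub.evalI_consI, Sub.evalL_consI, Sub.evalI_id, Sub.evalL_id]

theorem Tm.eval_instI (b a : Tm) (i l : Env) :
    (b.instI a).eval i l = b.eval (scons (a.eval i l) i) l := by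
  simp only [Tm.instI, Tm.eval_subst, Sub.evalI_consI, Sub.evalL_consI, Sub.evalI_id, Sub.evalL_id]

theorem Tm.eval_instL (b a : Tm) (i l : Env) :
    (b.instL a).eval i l = b.eval i (scons (a.eval i l) l) := by
  simp only [Tm.instL, Tm.eval_subst, Sub.evalI_consL, Sub.evalL_consL, Sub.evalI_id, Sub.evalL_id]

/-- The `k` variables of `a` occupy the lowest indices of the combined region, so `b` reads its
remaining variables after dropping them. -/
theorem Tm.eval_cutL (b a : Tm) (k : ℕ) (i l : Env) :
    (b.cutL a k).eval i l = b.eval i (scons (a.eval i l) (drop k l)) := by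
  simp only [Tm.cutL, Tm.eval_subst, Sub.evalI_consL, Sub.evalL_consL]
  rfl

end

/-! ### Satisfaction and validity -/

/-- The environment `i` satisfies the intuitionistic region `Δ`. -/
def SatI : List Ty → Env → Prop
  | [], _ => True
  | A :: Δ, i => SatI Δ (drop 1 i) ∧ i 0 ∈ (A.eval (drop 1 i) nilEnv).El

/-- The environments `l` and `l'` satisfy the linear region `Ξ` over `i` and agree on it. -/
def SatL (i : Env) : List Ty → Env → Env → Prop
  | [], _, _ => True
  | A :: Ξ, l, l' => l 0 = l' 0 ∧ l 0 ∈ (A.eval i nilEnv).El ∧ SatL i Ξ (drop 1 l) (drop 1 l')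

/-- `A` and `B` have the same interpretation over `Δ`, independently of the linear variables. -/
def TyOK (Δ : List Ty) (A B : Ty) : Prop :=
  ∀ i, SatI Δ i → ∀ l l', A.eval i l = B.eval i l'

/-- The types of an intuitionistic region are independent of the linear variables. -/
def WfI : List Ty → Prop
  | [] => True
  | A :: Δ => WfI Δ ∧ TyOK Δ A A

/-- Semantic well-formedness of contexts. -/
def CtxOK (Δ Ξ : List Ty) : Prop := WfI Δ ∧ ∀ A ∈ Ξ, TyOK Δ A A

/-- `a` and `b` have the same interpretation over `Δ; Ξ`, and it is an element of `A`. -/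
def TmOK (Δ Ξ : List Ty) (a b : Tm) (A : Ty) : Prop :=
  ∀ i, SatI Δ i → ∀ l l', SatL i Ξ l l' →
    a.eval i l = b.eval i l' ∧ a.eval i l ∈ (A.eval i nilEnv).El

/-- Semantic validity of what stands to the right of the turnstile. -/
def Body.Valid (Δ Ξ : List Ty) : Body → Prop
  | .ty A => TyOK Δ A A
  | .tyEq A B => TyOK Δ A B
  | .tm a A => TyOK Δ A A ∧ TmOK Δ Ξ a a A
  | .tmEq a b A => TyOK Δ A A ∧ TmOK Δ Ξ a b A

/-- Semantic validity of judgements. -/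
def Judgement.Valid : Judgement → Prop
  | .ctx Δ Ξ => CtxOK Δ Ξ
  | .ctxEq Δ Ξ Δ' Ξ' => CtxOK Δ Ξ ∧ CtxOK Δ' Ξ' ∧ (∀ i, SatI Δ i ↔ SatI Δ' i) ∧
      List.Forall₂ (TyOK Δ) Ξ Ξ'
  | .ent Δ Ξ J => CtxOK Δ Ξ ∧ J.Valid Δ Ξ

/-- The two linear environments are interchangeable. `TyOK Δ` is thus a partial equivalence
relation, reflexive exactly on types that do not depend on linear variables over `Δ`; `SatL` and
`TmOK` behave in the same way. -/
theorem TyOK.symm {Δ A B} (h : TyOK Δ A B) : TyOK Δ B A := fun i hi l l' => (h i hi l' l).symm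

theorem TyOK.trans {Δ A B C} (h : TyOK Δ A B) (h' : TyOK Δ B C) : TyOK Δ A C :=
  fun i hi l l' => (h i hi l l).trans (h' i hi l l')

theorem TyOK.left {Δ A B} (h : TyOK Δ A B) : TyOK Δ A A := h.trans h.symm

theorem SatL.symm {i Ξ} : ∀ {l l'}, SatL i Ξ l l' → SatL i Ξ l' l := by
  induction Ξ with
  | nil => exact fun _ => trivial
  | cons A Ξ ih => exact fun h => ⟨h.1.symm, h.1 ▸ h.2.1, ih h.2.2⟩

theorem SatL.trans {i Ξ} : ∀ {l l' l''}, SatL i Ξ l l' → SatL i Ξ l' l'' → SatL i Ξ l l'' := by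
  induction Ξ with
  | nil => exact fun _ _ => trivial
  | cons A Ξ ih => exact fun h h' => ⟨h.1.trans h'.1, h.2.1, ih h.2.2 h'.2.2⟩

theorem SatL.right {i Ξ l l'} (h : SatL i Ξ l l') : SatL i Ξ l' l' := h.symm.trans h

theorem SatL.left {i Ξ l l'} (h : SatL i Ξ l l') : SatL i Ξ l l := h.trans h.symm

theorem satL_append {i Ξ Ξ'} : ∀ {l l'}, SatL i (Ξ' ++ Ξ) l l' ↔
    SatL i Ξ' l l' ∧ SatL i Ξ (drop Ξ'.length l) (drop Ξ'.length l') := by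
  induction Ξ' with
  | nil => exact fun {l l'} => (iff_of_eq (true_and _)).symm
  | cons A Ξ' ih =>
    intro l l'
    simp only [List.cons_append, SatL, ih, and_assoc, List.length_cons, drop_drop]

theorem satL_map {i i' : Env} {f : Ty → Ty} {Ξ : List Ty}
    (h : ∀ A ∈ Ξ, (f A).eval i nilEnv = A.eval i' nilEnv) :
    ∀ {l l'}, SatL i (Ξ.map f) l l' ↔ SatL i' Ξ l l' := by
  induction Ξ with
  | nil => exact Iff.rfl
  | cons A Ξ ih =>
    intro l l'
    simp only [List.map_cons, SatL, h A List.mem_cons_self,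
      ih fun B hB => h B (List.mem_cons_of_mem A hB)]

theorem satL_wkCtx {i : Env} {Ξ : List Ty} {l l' : Env} :
    SatL i (wkCtx Ξ) l l' ↔ SatL (drop 1 i) Ξ l l' :=
  satL_map fun A _ => A.eval_wk _ _

/-- Conversion along equal linear regions: equal types have the same code, hence the same elements.
-/
theorem satL_congr {Δ i} (hi : SatI Δ i) {Ξ Ξ' : List Ty} (h : List.Forall₂ (TyOK Δ) Ξ Ξ') :
    ∀ {l l'}, SatL i Ξ l l' ↔ SatL i Ξ' l l' := by
  induction h with
  | nil => exact Iff.rfl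
  | cons h _ ih =>
    intro l l'
    simp only [SatL, ih, h i hi nilEnv nilEnv]

theorem SatI.drop {Δ} : ∀ {Δ' : List Ty} {i}, SatI (Δ' ++ Δ) i → SatI Δ (drop Δ'.length i) := by
  intro Δ'
  induction Δ' with
  | nil => exact fun h => h
  | cons A Δ' ih =>
    intro i h
    have := ih h.1
    rwa [drop_drop] at this

theorem WfI.of_append {Δ} : ∀ {Δ' : List Ty}, WfI (Δ' ++ Δ) → WfI Δ := by
  intro Δ'
  induction Δ' with
  | nil => exact fun h => h
  | cons A Δ' ih => exact fun h => ih h.1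

theorem TmOK.symm {Δ Ξ a b A} (h : TmOK Δ Ξ a b A) : TmOK Δ Ξ b a A := fun i hi l l' hl =>
  have h' := h i hi l' l hl.symm
  ⟨h'.1.symm, h'.1 ▸ h'.2⟩

theorem TmOK.trans {Δ Ξ a b c A} (h : TmOK Δ Ξ a b A) (h' : TmOK Δ Ξ b c A) : TmOK Δ Ξ a c A :=
  fun i hi l l' hl =>
    have h₁ := h i hi l l hl.left
    ⟨h₁.1.trans (h' i hi l l' hl).1, h₁.2⟩

theorem TmOK.left {Δ Ξ a b A} (h : TmOK Δ Ξ a b A) : TmOK Δ Ξ a a A := h.trans h.symm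

theorem TmOK.right {Δ Ξ a b A} (h : TmOK Δ Ξ a b A) : TmOK Δ Ξ b b A := h.symm.left

/-- A valid term is equal to every term with the same interpretation. -/
theorem TmOK.of_eval_eq {Δ Ξ a b A} (h : TmOK Δ Ξ a a A)
    (hb : ∀ i, SatI Δ i → ∀ l, SatL i Ξ l l → a.eval i l = b.eval i l) : TmOK Δ Ξ a b A :=
  fun i hi l l' hl =>
    have h₁ := h i hi l l' hl
    ⟨h₁.1.trans (hb i hi l' hl.right), h₁.2⟩

/-- Over an empty linear region a valid term is independent of the linear variables. -/
theorem TmOK.eval_nil {Δ a b A} (h : TmOK Δ [] a b A) {i} (hi : SatI Δ i) (l l' : Env) :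
    a.eval i l = b.eval i l' :=
  (h i hi l l' trivial).1

theorem TmOK.mem_nil {Δ a b A} (h : TmOK Δ [] a b A) {i} (hi : SatI Δ i) (l : Env) :
    a.eval i l ∈ (A.eval i nilEnv).El :=
  (h i hi l l trivial).2

theorem CtxOK.append {Δ Ξ Ξ'} (h : CtxOK Δ Ξ) (h' : CtxOK Δ Ξ') : CtxOK Δ (Ξ' ++ Ξ) :=
  ⟨h.1, fun A hA => (List.mem_append.1 hA).elim (h'.2 A) (h.2 A)⟩

theorem CtxOK.tail {Δ Ξ A} (h : CtxOK Δ (A :: Ξ)) : CtxOK Δ Ξ :=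
  ⟨h.1, fun B hB => h.2 B (List.mem_cons_of_mem A hB)⟩

theorem CtxOK.head {Δ Ξ A} (h : CtxOK Δ (A :: Ξ)) : TyOK Δ A A := h.2 A List.mem_cons_self

theorem CtxOK.cons {Δ Ξ A} (h : CtxOK Δ Ξ) (hA : TyOK Δ A A) : CtxOK Δ (A :: Ξ) :=
  ⟨h.1, List.forall_mem_cons.2 ⟨hA, h.2⟩⟩

theorem TyOK.wk {Δ A B C} (h : TyOK Δ A B) : TyOK (C :: Δ) A.wk B.wk := fun i hi l l' => by
  rw [Ty.eval_wk, Ty.eval_wk]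
  exact h _ hi.1 l l'

theorem CtxOK.wk {Δ Ξ A} (h : CtxOK Δ Ξ) (hA : TyOK Δ A A) : CtxOK (A :: Δ) (wkCtx Ξ) := by
  refine ⟨⟨h.1, hA⟩, fun B hB => ?_⟩
  obtain ⟨B, hB', rfl⟩ := List.mem_map.1 hB
  exact (h.2 B hB').wk

/-- Extension of a satisfying environment. -/
theorem SatI.scons {Δ A i x} (hi : SatI Δ i) (hx : x ∈ (A.eval i nilEnv).El) :
    SatI (A :: Δ) (scons x i) := ⟨hi, hx⟩

theorem SatL.scons {i A Ξ l l' x} (h : SatL i Ξ l l') (hx : x ∈ (A.eval i nilEnv).El) :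
    SatL i (A :: Ξ) (scons x l) (ILDTT.scons x l') := ⟨rfl, hx, h⟩

/-! ### Morphisms of intuitionistic regions -/

/-- Action on types and terms of something that changes the variables. -/
def Body.map (f : Ty → Ty) (g : Tm → Tm) : Body → Body
  | .ty A => .ty (f A)
  | .tyEq A A' => .tyEq (f A) (f A')
  | .tm a A => .tm (g a) (f A)
  | .tmEq a a' A => .tmEq (g a) (g a') (f A)

theorem Body.ren_eq_map (r : Ren) (J : Body) : J.ren r = J.map (Ty.ren r) (Tm.ren r) := by
  cases J <;> rfl

theorem Body.subst_eq_map (s : Sub) (J : Body) : J.subst s = J.map (Ty.subst s) (Tm.subst s) := by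
  cases J <;> rfl

/-- Validity is preserved by operations on types and terms that are interpreted by a map of
environments. -/
theorem Judgement.Valid.map {Δ₁ Δ₂ Ξ : List Ty} {J : Body} {m : Env → Env} {f : Ty → Ty}
    {g : Tm → Tm} (hΔ : WfI Δ₂) (hm : ∀ i, SatI Δ₂ i → SatI Δ₁ (m i))
    (hf : ∀ A i, SatI Δ₂ i → ∀ l, (f A).eval i l = A.eval (m i) l)
    (hg : ∀ a i, SatI Δ₂ i → ∀ l, (g a).eval i l = a.eval (m i) l)
    (h : (Judgement.ent Δ₁ Ξ J).Valid) : (Judgement.ent Δ₂ (Ξ.map f) (J.map f g)).Valid := by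
  have key : ∀ {A B}, TyOK Δ₁ A B → TyOK Δ₂ (f A) (f B) := fun h i hi l l' => by
    rw [hf _ i hi, hf _ i hi]
    exact h _ (hm i hi) l l'
  have key' : ∀ {a b A}, TmOK Δ₁ Ξ a b A → TmOK Δ₂ (Ξ.map f) (g a) (g b) (f A) :=
    fun h i hi l l' hl => by
      rw [hg _ i hi, hg _ i hi, hf _ i hi]
      exact h _ (hm i hi) l l' ((satL_map fun A _ => hf A i hi nilEnv).1 hl)
  refine ⟨⟨hΔ, fun B hB => ?_⟩, ?_⟩
  · obtain ⟨B, hB', rfl⟩ := List.mem_map.1 hB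
    exact key (h.1.2 B hB')
  · cases J with
    | ty A => exact key h.2
    | tyEq A B => exact key h.2
    | tm a A => exact ⟨key h.2.1, key' h.2.2⟩
    | tmEq a b A => exact ⟨key h.2.1, key' h.2.2⟩

/-- Extension of a map of environments under an intuitionistic binder. -/
def upEnv (m : Env → Env) (i : Env) : Env := scons (i 0) (m (drop 1 i))

/-- Action of a family of operations on a telescope. -/
def mapTele (f : ℕ → Ty → Ty) : List Ty → List Ty
  | [] => []
  | A :: Δ' => f Δ'.length A :: mapTele f Δ'

theorem length_mapTele (f : ℕ → Ty → Ty) (Δ' : List Ty) : (mapTele f Δ').length = Δ'.length := by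
  induction Δ' with
  | nil => rfl
  | cons A Δ' ih => simp only [mapTele, List.length_cons, ih]

theorem renTele_eq (r : Ren) (Δ' : List Ty) :
    renTele r Δ' = mapTele (fun k => Ty.ren (Ren.upI^[k] r)) Δ' := by
  induction Δ' with
  | nil => rfl
  | cons A Δ' ih => simp only [renTele, mapTele, ih]

theorem substTele_eq (s : Sub) (Δ' : List Ty) :
    substTele s Δ' = mapTele (fun k => Ty.subst (Sub.upI^[k] s)) Δ' := by
  induction Δ' with
  | nil => rfl
  | cons A Δ' ih => simp only [substTele, mapTele, ih]

/-- Both conclusions are proved together by induction on the telescope, as each new type is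
evaluated in an environment already known to satisfy the shorter telescope. The restriction in `hf`
to tails satisfying `Δ₂` is needed for substitution, where only there is the substituted term known
to be independent of linear variables. -/
theorem sat_mapTele {Δ₁ Δ₂ : List Ty} {m : Env → Env} {f : ℕ → Ty → Ty} (hΔ : WfI Δ₂)
    (hm : ∀ i, SatI Δ₂ i → SatI Δ₁ (m i))
    (hf : ∀ k A i, SatI Δ₂ (drop k i) → ∀ l, (f k A).eval i l = A.eval (upEnv^[k] m i) l)
    (Δ' : List Ty) (h : WfI (Δ' ++ Δ₁)) : WfI (mapTele f Δ' ++ Δ₂) ∧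
      ∀ i, SatI (mapTele f Δ' ++ Δ₂) i → SatI (Δ' ++ Δ₁) (upEnv^[Δ'.length] m i) := by
  induction Δ' with
  | nil => exact ⟨hΔ, hm⟩
  | cons A Δ' ih =>
    obtain ⟨ih₁, ih₂⟩ := ih h.1
    have hd : ∀ {i}, SatI (mapTele f Δ' ++ Δ₂) i → SatI Δ₂ (drop Δ'.length i) := fun hi => by
      have := hi.drop
      rwa [length_mapTele] at this
    refine ⟨⟨ih₁, fun i hi l l' => ?_⟩, fun i hi => ?_⟩
    · rw [hf _ _ _ (hd hi), hf _ _ _ (hd hi)]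
      exact h.2 _ (ih₂ i hi) l l'
    · rw [List.length_cons, Function.iterate_succ_apply']
      refine ⟨ih₂ _ hi.1, ?_⟩
      have := hi.2
      rwa [hf _ _ _ (hd hi.1)] at this

theorem Judgement.Valid.mapTele {Δ₁ Δ₂ Ξ : List Ty} {J : Body} {m : Env → Env}
    {f : ℕ → Ty → Ty} {g : ℕ → Tm → Tm} (hΔ : WfI Δ₂) (hm : ∀ i, SatI Δ₂ i → SatI Δ₁ (m i))
    (hf : ∀ k A i, SatI Δ₂ (drop k i) → ∀ l, (f k A).eval i l = A.eval (upEnv^[k] m i) l)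
    (hg : ∀ k a i, SatI Δ₂ (drop k i) → ∀ l, (g k a).eval i l = a.eval (upEnv^[k] m i) l)
    (Δ' : List Ty) (h : (Judgement.ent (Δ' ++ Δ₁) Ξ J).Valid) :
    (Judgement.ent (ILDTT.mapTele f Δ' ++ Δ₂) (Ξ.map (f Δ'.length))
      (J.map (f Δ'.length) (g Δ'.length))).Valid := by
  obtain ⟨h₁, h₂⟩ := sat_mapTele hΔ hm hf Δ' h.1.1
  have hd : ∀ i, SatI (ILDTT.mapTele f Δ' ++ Δ₂) i → SatI Δ₂ (drop Δ'.length i) := fun i hi => by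
    have := hi.drop
    rwa [length_mapTele] at this
  exact h.map h₁ h₂ (fun A i hi => hf _ A i (hd i hi)) fun a i hi => hg _ a i (hd i hi)

theorem upI_iterate_i (r : Ren) (k : ℕ) (i : Env) :
    (fun n => i ((Ren.upI^[k] r).i n)) = upEnv^[k] (fun i n => i (r.i n)) i := by
  induction k generalizing i with
  | zero => rfl
  | succ k ih =>
    rw [Function.iterate_succ_apply', Function.iterate_succ_apply', upEnv, ← ih (drop 1 i)]
    funext n
    cases n <;> rfl

theorem upI_iterate_l (r : Ren) (k : ℕ) : (Ren.upI^[k] r).l = r.l := by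
  induction k with
  | zero => rfl
  | succ k ih => rw [Function.iterate_succ_apply', Ren.upI, ih]

/-- Common source of intuitionistic weakening and exchange: both rename variables in a way that
sends satisfying environments to satisfying environments. -/
theorem Judgement.Valid.renTele {Δ₁ Δ₂ Ξ : List Ty} {J : Body} {r : Ren} (hr : ∀ n, r.l n = n)
    (hΔ : WfI Δ₂) (hm : ∀ i, SatI Δ₂ i → SatI Δ₁ fun n => i (r.i n)) (Δ' : List Ty)
    (h : (Judgement.ent (Δ' ++ Δ₁) Ξ J).Valid) :
    (Judgement.ent (ILDTT.renTele r Δ' ++ Δ₂) (Ξ.map (Ty.ren (Ren.upI^[Δ'.length] r)))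
      (J.ren (Ren.upI^[Δ'.length] r))).Valid := by
  rw [renTele_eq, Body.ren_eq_map]
  refine Judgement.Valid.mapTele (f := fun k => Ty.ren (Ren.upI^[k] r))
    (g := fun k => Tm.ren (Ren.upI^[k] r)) hΔ hm ?_ ?_ Δ' h
  · intro k A i _ l
    simp only [Ty.eval_ren, upI_iterate_i, upI_iterate_l, hr]
  · intro k a i _ l
    simp only [Tm.eval_ren, upI_iterate_i, upI_iterate_l, hr]

/-- On the left `a` is evaluated at the current `l`, on the right at `nilEnv`, so that the right
side is a map of intuitionistic environments alone. The two agree because `a` is valid over the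
empty linear region. -/
theorem upI_iterate_evalI {Δ a A} (ha : TmOK Δ [] a a A) (k : ℕ) (i l : Env)
    (hi : SatI Δ (drop k i)) : (Sub.upI^[k] (Sub.id.consI a)).evalI i l =
      upEnv^[k] (fun i => scons (a.eval i nilEnv) i) i := by
  induction k generalizing i with
  | zero =>
    have h : a.eval i l = a.eval i nilEnv := ha.eval_nil hi l nilEnv
    rw [Function.iterate_zero, id, Sub.evalI_consI, Sub.evalI_id, h, Function.iterate_zero, id]
  | succ k ih =>
    rw [Function.iterate_succ_apply', Function.iterate_succ_apply', upEnv,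
      ← ih (drop 1 i) (by rwa [drop_drop]), ← Sub.evalI_upI, scons_drop_one]

theorem upI_iterate_evalL (a : Tm) (k : ℕ) (i l : Env) :
    (Sub.upI^[k] (Sub.id.consI a)).evalL i l = l := by
  induction k generalizing i with
  | zero => rfl
  | succ k ih =>
    rw [Function.iterate_succ_apply', ← scons_drop_one i, Sub.evalL_upI, ih]

theorem Judgement.Valid.substTele {Δ Ξ : List Ty} {A : Ty} {a : Tm} {J : Body} (Δ' : List Ty)
    (h : (Judgement.ent (Δ' ++ A :: Δ) Ξ J).Valid) (ha : (Judgement.ent Δ [] (.tm a A)).Valid) :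
    (Judgement.ent (ILDTT.substTele (Sub.id.consI a) Δ' ++ Δ)
      (Ξ.map (Ty.subst (Sub.upI^[Δ'.length] (Sub.id.consI a))))
      (J.subst (Sub.upI^[Δ'.length] (Sub.id.consI a)))).Valid := by
  rw [substTele_eq, Body.subst_eq_map]
  refine Judgement.Valid.mapTele (m := fun i => scons (a.eval i nilEnv) i)
    (f := fun k => Ty.subst (Sub.upI^[k] (Sub.id.consI a)))
    (g := fun k => Tm.subst (Sub.upI^[k] (Sub.id.consI a))) ha.1.1 ?_ ?_ ?_ Δ' h
  · exact fun i hi => hi.scons (ha.2.2.mem_nil hi nilEnv)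
  · intro k A i hi l
    simp only [Ty.eval_subst, upI_iterate_evalI ha.2.2 k i l hi, upI_iterate_evalL]
  · intro k a i hi l
    simp only [Tm.eval_subst, upI_iterate_evalI ha.2.2 k i l hi, upI_iterate_evalL]

-- Linear exchange, variables, conversion and cut

theorem satL_swap {i : Env} {A A' : Ty} {Ξ : List Ty} (Ξ' : List Ty) {l l' : Env}
    (h : SatL i (Ξ' ++ A :: A' :: Ξ) l l') :
    SatL i (Ξ' ++ A' :: A :: Ξ) (fun n => l (liftIdx^[Ξ'.length] swapIdx n))
      fun n => l' (liftIdx^[Ξ'.length] swapIdx n) := by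
  induction Ξ' generalizing l l' with
  | nil =>
    obtain ⟨h₁, h₂, h₃, h₄, h₅⟩ := h
    exact ⟨h₃, h₄, h₁, h₂, h₅⟩
  | cons B Ξ' ih =>
    rw [List.length_cons, Function.iterate_succ_apply']
    exact ⟨h.1, h.2.1, ih h.2.2⟩

theorem Judgement.Valid.linExch {Δ Ξ : List Ty} {A A' : Ty} {J : Body} (Ξ' : List Ty)
    (h : (Judgement.ent Δ (Ξ' ++ A' :: A :: Ξ) J).Valid) :
    (Judgement.ent Δ (Ξ' ++ A :: A' :: Ξ) (J.renL (liftIdx^[Ξ'.length] swapIdx))).Valid := by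
  have key : ∀ {a b B}, TmOK Δ (Ξ' ++ A' :: A :: Ξ) a b B → TmOK Δ (Ξ' ++ A :: A' :: Ξ)
      (a.ren ⟨id, liftIdx^[Ξ'.length] swapIdx⟩) (b.ren ⟨id, liftIdx^[Ξ'.length] swapIdx⟩) B :=
    fun h i hi l l' hl => by
      rw [Tm.eval_ren, Tm.eval_ren]
      exact h i hi _ _ (satL_swap Ξ' hl)
  refine ⟨⟨h.1.1, fun B hB => h.1.2 B ?_⟩, ?_⟩
  · simp only [List.mem_append, List.mem_cons] at hB ⊢
    tauto
  · cases J with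
    | ty A => exact h.2
    | tyEq A B => exact h.2
    | tm a A => exact ⟨h.2.1, key h.2.2⟩
    | tmEq a b A => exact ⟨h.2.1, key h.2.2⟩

theorem valid_intVar {Δ : List Ty} {A : Ty} (Δ' : List Ty)
    (h : CtxOK (Δ' ++ A :: Δ) []) :
    (Judgement.ent (Δ' ++ A :: Δ) []
      (.tm (.ivar Δ'.length) (A.ren (Ren.shift (Δ'.length + 1) 0)))).Valid := by
  have key : ∀ {i}, SatI (Δ' ++ A :: Δ) i →
      SatI Δ (drop (Δ'.length + 1) i) ∧ i Δ'.length ∈ (A.eval (drop (Δ'.length + 1) i) nilEnv).El :=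
    fun {i} hi => by
      have := hi.drop
      simpa only [SatI, drop_drop, Nat.add_comm 1, drop, Nat.zero_add] using this
  refine ⟨h, fun i hi l l' => ?_, fun i hi l l' _ => ⟨rfl, ?_⟩⟩
  · rw [Ty.eval_ren, Ty.eval_ren]
    exact h.1.of_append.2 _ (key hi).1 _ _
  · rw [Ty.eval_ren]
    exact (key hi).2

theorem TmOK.conv {Δ Δ' Ξ Ξ' : List Ty} {a b : Tm} {A A' : Ty} (h : TmOK Δ Ξ a b A)
    (hc : (Judgement.ctxEq Δ Ξ Δ' Ξ').Valid) (hA : TyOK Δ A A') : TmOK Δ' Ξ' a b A' :=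
  fun i hi l l' hl => by
    have hi' := (hc.2.2.1 i).2 hi
    rw [← hA i hi' nilEnv nilEnv]
    exact h i hi' l l' ((satL_congr hi' hc.2.2.2).2 hl)

theorem TyOK.conv {Δ Δ' : List Ty} {A B : Ty} (h : TyOK Δ A B)
    (hc : ∀ i, SatI Δ i ↔ SatI Δ' i) : TyOK Δ' A B := fun i hi => h i ((hc i).2 hi)

/-- Validity of `a` gives it the same value in `A` at both linear environments, and this common
value may be prepended to the environments for `b` and `b'`. -/
theorem TmOK.cutL {Δ Ξ Ξ' : List Ty} {a b b' : Tm} {A B : Ty} (hb : TmOK Δ (A :: Ξ) b b' B)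
    (ha : TmOK Δ Ξ' a a A) :
    TmOK Δ (Ξ' ++ Ξ) (b.cutL a Ξ'.length) (b'.cutL a Ξ'.length) B := fun i hi l l' hl => by
  rw [Tm.eval_cutL, Tm.eval_cutL]
  obtain ⟨hl', hl⟩ := satL_append.1 hl
  obtain ⟨h₁, h₂⟩ := ha i hi l l' hl'
  rw [← h₁]
  exact hb i hi _ _ (hl.scons h₂)

theorem valid_intCExtEq {Δ Ξ Δ' Ξ' : List Ty} {A B : Ty}
    (h : (Judgement.ctxEq Δ Ξ Δ' Ξ').Valid) (hA : TyOK Δ A B) :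
    (Judgement.ctxEq (A :: Δ) (wkCtx Ξ) (B :: Δ') (wkCtx Ξ')).Valid := by
  obtain ⟨h₁, h₂, h₃, h₄⟩ := h
  refine ⟨h₁.wk hA.left, h₂.wk (hA.symm.left.conv h₃), fun i => ?_, ?_⟩
  · refine ⟨fun hi => ⟨(h₃ _).1 hi.1, ?_⟩, fun hi => ?_⟩
    · rw [← hA _ hi.1 nilEnv nilEnv]
      exact hi.2
    · have := (h₃ _).2 hi.1
      refine ⟨this, ?_⟩
      rw [hA _ this nilEnv nilEnv]
      exact hi.2
  · refine List.forall₂_map_left_iff.2 (List.forall₂_map_right_iff.2 (h₄.imp ?_))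
    exact fun A B h => h.wk

theorem valid_ctxEq_symm {Δ Ξ Δ' Ξ' : List Ty} (h : (Judgement.ctxEq Δ Ξ Δ' Ξ').Valid) :
    (Judgement.ctxEq Δ' Ξ' Δ Ξ).Valid :=
  ⟨h.2.1, h.1, fun i => (h.2.2.1 i).symm, (h.2.2.2.imp fun _ _ h' => h'.symm.conv h.2.2.1).flip⟩

theorem valid_ctxEq_trans {Δ Ξ Δ' Ξ' Δ'' Ξ'' : List Ty} (h : (Judgement.ctxEq Δ Ξ Δ' Ξ').Valid)
    (h' : (Judgement.ctxEq Δ' Ξ' Δ'' Ξ'').Valid) : (Judgement.ctxEq Δ Ξ Δ'' Ξ'').Valid := by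
  refine ⟨h.1, h'.2.1, fun i => (h.2.2.1 i).trans (h'.2.2.1 i), ?_⟩
  have h₁ := h.2.2.2
  -- The second comparison of linear regions is over `Δ'`; it is moved to `Δ` before composing.
  have h₂ := h'.2.2.2.imp fun _ _ h' => h'.conv fun i => (h.2.2.1 i).symm
  clear h h'
  induction h₁ generalizing Ξ'' with
  | nil =>
    cases h₂
    exact .nil
  | cons hA _ ih =>
    cases h₂ with
    | cons hB h₂ => exact .cons (hA.trans hB) (ih h₂)

/-! ### Interpretation of linear program contexts -/

/-- Extension of an environment by a list of values. -/
def prepend (xs : List ZFSet.{0}) (i : Env) : Env :=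
  match xs with
  | [] => i
  | x :: xs => scons x (prepend xs i)

theorem prepend_append (xs ys : List ZFSet) (i : Env) :
    prepend (xs ++ ys) i = prepend xs (prepend ys i) := by
  induction xs with
  | nil => rfl
  | cons x xs ih => simp only [List.cons_append, prepend, ih]

theorem prepend_add (xs : List ZFSet) (i : Env) (n : ℕ) : prepend xs i (n + xs.length) = i n := by
  induction xs with
  | nil => rfl
  | cons x xs ih => exact ih

theorem prepend_lt (xs : List ZFSet) (i j : Env) {n : ℕ} (h : n < xs.length) :
    prepend xs i n = prepend xs j n := by
  induction xs generalizing n with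
  | nil => exact absurd h (Nat.not_lt_zero n)
  | cons x xs ih =>
    cases n with
    | zero => rfl
    | succ n => exact ih (Nat.lt_of_succ_lt_succ h)

/-- The body of a `let` below `C` has the variables of the `let` innermost; once the `let` is moved
out, those of `C` are innermost. Reading indices through the swap makes both environments give the
same values. -/
theorem prepend_blockSwap (xs ys : List ZFSet) (i : Env) :
    (fun n => prepend ys (prepend xs i) (blockSwap xs.length ys.length n)) =
      prepend xs (prepend ys i) := by
  funext n
  unfold blockSwap
  split_ifs with h₁ h₂
  · rw [prepend_add]
    exact prepend_lt _ _ _ h₁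
  · obtain ⟨m, rfl⟩ := Nat.exists_eq_add_of_le' (Nat.le_of_not_lt h₁)
    rw [prepend_add, Nat.add_sub_cancel]
    exact prepend_lt _ _ _ (by omega)
  · obtain ⟨m, rfl⟩ := Nat.exists_eq_add_of_le' (Nat.le_of_not_lt h₂)
    rw [Nat.add_comm xs.length, ← Nat.add_assoc, prepend_add, Nat.add_assoc,
      Nat.add_comm ys.length, ← Nat.add_assoc, prepend_add, prepend_add, prepend_add]

theorem prepend_liftIdx (xs : List ZFSet) (i : Env) (g : ℕ → ℕ) :
    (fun n => prepend xs i (liftIdx^[xs.length] g n)) = prepend xs fun n => i (g n) := by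
  induction xs with
  | nil => rfl
  | cons x xs ih =>
    rw [List.length_cons, Function.iterate_succ_apply', prepend, scons_comp_liftIdx, ih, prepend]

theorem iterate_upL_i (r : Ren) (k : ℕ) : (Ren.upL^[k] r).i = r.i := by
  induction k with
  | zero => rfl
  | succ k ih => rw [Function.iterate_succ_apply', Ren.upL, ih]

theorem iterate_upL_l (r : Ren) (k : ℕ) : (Ren.upL^[k] r).l = liftIdx^[k] r.l := by
  induction k with
  | zero => rfl
  | succ k ih => rw [Function.iterate_succ_apply', Function.iterate_succ_apply', Ren.upL, ih]

theorem iterate_upI_i (r : Ren) (k : ℕ) : (Ren.upI^[k] r).i = liftIdx^[k] r.i := by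
  induction k with
  | zero => rfl
  | succ k ih => rw [Function.iterate_succ_apply', Function.iterate_succ_apply', Ren.upI, ih]

/-- The interpretation of a filled frame depends only on the interpretation of what fills it. -/
theorem Frame.eval_plug_congr (F : Frame) (r : Ren) (e e' : Tm) (i l : Env)
    (h : ∀ xs ys : List ZFSet, xs.length = F.bindI → ys.length = F.bindL →
      e.eval (prepend xs i) (prepend ys l) =
        e'.eval (prepend xs fun n => i (r.i n)) (prepend ys fun n => l (r.l n))) :
    ((F.ren r).plug e).eval i l = (F.plug e').eval (fun n => i (r.i n)) fun n => l (r.l n) := by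
  cases F
  case sletB t =>
    have h' := fun x y => h [x] [y] rfl rfl
    simp only [prepend] at h'
    simp only [Frame.ren, Frame.plug, Tm.eval, Tm.eval_ren, h']
  case tletB t =>
    have h' := fun x y => h [] [x, y] rfl rfl
    simp only [prepend] at h'
    simp only [Frame.ren, Frame.plug, Tm.eval, Tm.eval_ren, h']
  case ilam A =>
    have h' := fun x => h [x] [] rfl rfl
    simp only [prepend] at h'
    simp only [Frame.ren, Frame.plug, Tm.eval, Ty.eval_ren, h']
  case idletB a a' p =>
    have h' := fun x => h [x] [] rfl rfl
    simp only [prepend] at h'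
    simp only [Frame.ren, Frame.plug, Tm.eval, Tm.eval_ren, h']
  case letbangB t =>
    have h' := fun x => h [x] [] rfl rfl
    simp only [prepend] at h'
    simp only [Frame.ren, Frame.plug, Tm.eval, Tm.eval_ren, h']
  case llam A =>
    have h' := fun x => h [] [x] rfl rfl
    simp only [prepend] at h'
    simp only [Frame.ren, Frame.plug, Tm.eval, Ty.eval_ren, h']
  case caseL t d =>
    have h' := fun x => h [] [x] rfl rfl
    simp only [prepend] at h'
    simp only [Frame.ren, Frame.plug, Tm.eval, Tm.eval_ren, h', Ren.upL, scons_comp_liftIdx]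
  case caseR t c =>
    have h' := fun x => h [] [x] rfl rfl
    simp only [prepend] at h'
    simp only [Frame.ren, Frame.plug, Tm.eval, Tm.eval_ren, h', Ren.upL, scons_comp_liftIdx]
  all_goals
    have h' := h [] [] rfl rfl
    simp only [prepend] at h'
    simp only [Frame.ren, Frame.plug, Tm.eval, Tm.eval_ren, h', Ren.upL, Ren.upI,
      scons_comp_liftIdx]

/-- The interpretation of `C[e]` depends only on the interpretation of `e`. -/
theorem PCtx.eval_plug_congr (C : PCtx) (r : Ren) (e e' : Tm) (i l : Env)
    (h : ∀ xs ys : List ZFSet, xs.length = C.bindI → ys.length = C.bindL →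
      e.eval (prepend xs i) (prepend ys l) =
        e'.eval (prepend xs fun n => i (r.i n)) (prepend ys fun n => l (r.l n))) :
    ((C.ren r).plug e).eval i l = (C.plug e').eval (fun n => i (r.i n)) fun n => l (r.l n) := by
  induction C generalizing r i l with
  | nil => exact h [] [] rfl rfl
  | cons F C ih =>
    refine F.eval_plug_congr r _ _ i l fun xs ys hx hy => ?_
    have hi : (fun n => prepend xs i ((Ren.upL^[F.bindL] (Ren.upI^[F.bindI] r)).i n)) =
        prepend xs fun n => i (r.i n) := by
      rw [iterate_upL_i, iterate_upI_i, ← hx, prepend_liftIdx]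
    have hl : (fun n => prepend ys l ((Ren.upL^[F.bindL] (Ren.upI^[F.bindI] r)).l n)) =
        prepend ys fun n => l (r.l n) := by
      rw [iterate_upL_l, upI_iterate_l, ← hy, prepend_liftIdx]
    have := ih (Ren.upL^[F.bindL] (Ren.upI^[F.bindI] r)) (prepend xs i) (prepend ys l) ?_
    · rwa [hi, hl] at this
    · intro xs' ys' hx' hy'
      -- The binders of `C` lie inside those of `F`, so their values take the lower indices.
      have := h (xs' ++ xs) (ys' ++ ys)
        (by simp [hx, hx', PCtx.bindI, Nat.add_comm]) (by simp [hy, hy', PCtx.bindL, Nat.add_comm])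
      rw [hi, hl]
      simpa only [prepend_append] using this

/-- A `let` assigns values to the variables that it binds. -/
theorem Frame.IsLet.eval_plug {L : Frame} (h : L.IsLet) (i l : Env) :
    ∃ xs ys : List ZFSet, xs.length = L.bindI ∧ ys.length = L.bindL ∧
      (∀ e, (L.plug e).eval i l = e.eval (prepend xs i) (prepend ys l)) ∧
      ∀ (r : Ren) (i' l' : Env), (fun n => i' (r.i n)) = i → (fun n => l' (r.l n)) = l →
        ∀ e, ((L.ren r).plug e).eval i' l' = e.eval (prepend xs i') (prepend ys l') := by
  cases L <;> first | exact h.elim | skip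
  case sletB t =>
    refine ⟨[pfst (t.eval i l)], [psnd (t.eval i l)], rfl, rfl, fun e => rfl, ?_⟩
    rintro r i' l' rfl rfl e
    simp only [Frame.ren, Frame.plug, Tm.eval, Tm.eval_ren, prepend]
  case idletB a a' p =>
    refine ⟨[a.eval i l], [], rfl, rfl, fun e => rfl, ?_⟩
    rintro r i' l' rfl rfl e
    simp only [Frame.ren, Frame.plug, Tm.eval, Tm.eval_ren, prepend]
  case letstarB t => exact ⟨[], [], rfl, rfl, fun e => rfl, fun _ _ _ _ _ _ => rfl⟩
  case tletB t =>
    refine ⟨[], [psnd (t.eval i l), pfst (t.eval i l)], rfl, rfl, fun e => rfl, ?_⟩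
    rintro r i' l' rfl rfl e
    simp only [Frame.ren, Frame.plug, Tm.eval, Tm.eval_ren, prepend]
  case letbangB t =>
    refine ⟨[t.eval i l], [], rfl, rfl, fun e => rfl, ?_⟩
    rintro r i' l' rfl rfl e
    simp only [Frame.ren, Frame.plug, Tm.eval, Tm.eval_ren, prepend]

/-- A `let` only binds values computed from the outer environment. Weakened below `C` it computes
the same values, whatever `C` binds, so its position does not matter. -/
theorem eval_commLet (C : PCtx) {L : Frame} (hL : L.IsLet) (c : Tm) (i l : Env) :
    (C.plug ((L.ren (Ren.shift C.bindI C.bindL)).plug c)).eval i l =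
      (L.plug ((C.ren (Ren.shift L.bindI L.bindL)).plug
        (c.ren (C.exch L.bindI L.bindL)))).eval i l := by
  obtain ⟨xs, ys, hx, hy, h₁, h₂⟩ := hL.eval_plug i l
  rw [h₁]
  have hi : (fun n => prepend xs i ((Ren.shift L.bindI L.bindL).i n)) = i :=
    funext fun n => hx ▸ prepend_add xs i n
  have hl : (fun n => prepend ys l ((Ren.shift L.bindI L.bindL).l n)) = l :=
    funext fun n => hy ▸ prepend_add ys l n
  -- The environment is the one inside the `let`; pulling it back along the shift forgets `xs` and
  -- `ys` and leaves `i` and `l`.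
  have := C.eval_plug_congr (Ren.shift L.bindI L.bindL) (c.ren (C.exch L.bindI L.bindL))
    ((L.ren (Ren.shift C.bindI C.bindL)).plug c) (prepend xs i) (prepend ys l) ?_
  · rw [this, hi, hl]
  · intro xs' ys' hx' hy'
    rw [hi, hl, h₂ _ _ _ (funext fun n => hx' ▸ prepend_add xs' i n)
      (funext fun n => hy' ▸ prepend_add ys' l n), Tm.eval_ren, PCtx.exch, ← hx, ← hy, ← hx', ← hy',
      prepend_blockSwap, prepend_blockSwap]

/-- Here `e` is the branch selected by the value of `t` at `i`, `l` and `x` its payload. The choice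
is the same under all binders of `C`, since `t` occurs there weakened. -/
theorem eval_plug_case (C : PCtx) {t c d e : Tm} {i l : Env} {x : ZFSet}
    (h : ∀ i' l', caseOf (t.eval i l) (fun x => c.eval i' (scons x l'))
      (fun x => d.eval i' (scons x l')) = e.eval i' (scons x l')) :
    (C.plug (.case (t.ren (Ren.shift C.bindI C.bindL)) c d)).eval i l =
      ((C.ren (Ren.shift 0 1)).plug (e.ren (C.exch 0 1))).eval i (scons x l) := by
  refine (C.eval_plug_congr (Ren.shift 0 1) _ _ i (scons x l) ?_).symm
  intro xs' ys' hx' hy'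
  have hi : (fun n => prepend xs' i ((Ren.shift C.bindI C.bindL).i n)) = i :=
    funext fun n => hx' ▸ prepend_add xs' i n
  have hl : (fun n => prepend ys' l ((Ren.shift C.bindI C.bindL).l n)) = l :=
    funext fun n => hy' ▸ prepend_add ys' l n
  have hb := prepend_blockSwap [] xs' i
  have hb' := prepend_blockSwap [x] ys' l
  simp only [prepend, List.length_nil, List.length_singleton] at hb hb'
  rw [Tm.eval_ren, PCtx.exch, ← hx', ← hy', hb, hb']
  change _ = (Tm.case (t.ren (Ren.shift xs'.length ys'.length)) c d).eval (prepend xs' i)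
    (prepend ys' l)
  rw [Tm.eval, Tm.eval_ren, hx', hy', hi, hl, h]

theorem eval_commCase (C : PCtx) {t c d : Tm} {i l : Env} {X Y : ZFSet}
    (ht : t.eval i l ∈ disjSum X Y) :
    (C.plug (.case (t.ren (Ren.shift C.bindI C.bindL)) c d)).eval i l =
      (Tm.case t ((C.ren (Ren.shift 0 1)).plug (c.ren (C.exch 0 1)))
        ((C.ren (Ren.shift 0 1)).plug (d.ren (C.exch 0 1)))).eval i l := by
  rcases mem_disjSum.1 ht with ⟨x, _, hx⟩ | ⟨x, _, hx⟩
  · rw [Tm.eval, ← hx, caseOf_injl]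
    exact eval_plug_case C fun i' l' => by rw [← hx, caseOf_injl]
  · rw [Tm.eval, ← hx, caseOf_injr]
    exact eval_plug_case C fun i' l' => by rw [← hx, caseOf_injr]

/-! ### Type formers -/

theorem WfI.ctxOK_nil {Δ} (h : WfI Δ) : CtxOK Δ [] := ⟨h, fun _ h => absurd h List.not_mem_nil⟩

theorem TyOK.sig {Δ A A' B B'} (hA : TyOK Δ A A') (hB : TyOK (A :: Δ) B B') :
    TyOK Δ (.sig A B) (.sig A' B') := fun i hi l l' => by
  simp only [Ty.eval]
  refine congrArg Code.base (depSum_congr (by rw [hA i hi l l']) fun x hx => ?_)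
  -- `SatI` evaluates types at `nilEnv`, so the domain is moved there before the environment is
  -- extended.
  rw [hA.left i hi l nilEnv] at hx
  rw [hB _ (hi.scons hx) l l']

theorem TyOK.pi {Δ A A' B B'} (hA : TyOK Δ A A') (hB : TyOK (A :: Δ) B B') :
    TyOK Δ (.pi A B) (.pi A' B') := fun i hi l l' => by
  simp only [Ty.eval]
  refine Code.piOn_congr (hA i hi l l') fun x hx => ?_
  rw [hA.left i hi l nilEnv] at hx
  exact hB _ (hi.scons hx) l l'

/-- `A` and `A'` may be arbitrary because the interpretation of identity types does not look at
them. -/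
theorem TyOK.idt {Δ A A' B a a' b b'} (ha : TmOK Δ [] a a' B) (hb : TmOK Δ [] b b' B) :
    TyOK Δ (.idt A a b) (.idt A' a' b') := fun i hi l l' => by
  simp only [Ty.eval, ha.eval_nil hi l l', hb.eval_nil hi l l']

theorem TyOK.tensor {Δ A A' B B'} (hA : TyOK Δ A A') (hB : TyOK Δ B B') :
    TyOK Δ (.tensor A B) (.tensor A' B') := fun i hi l l' => by
  simp only [Ty.eval, hA i hi l l', hB i hi l l']

theorem TyOK.lolli {Δ A A' B B'} (hA : TyOK Δ A A') (hB : TyOK Δ B B') :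
    TyOK Δ (.lolli A B) (.lolli A' B') := fun i hi l l' => by
  simp only [Ty.eval, hA i hi l l', hB i hi l l']

theorem TyOK.and {Δ A A' B B'} (hA : TyOK Δ A A') (hB : TyOK Δ B B') :
    TyOK Δ (.and A B) (.and A' B') := fun i hi l l' => by
  simp only [Ty.eval, hA i hi l l', hB i hi l l']

theorem TyOK.plus {Δ A A' B B'} (hA : TyOK Δ A A') (hB : TyOK Δ B B') :
    TyOK Δ (.plus A B) (.plus A' B') := fun i hi l l' => by
  simp only [Ty.eval, hA i hi l l', hB i hi l l']

theorem TyOK.bang {Δ A A'} (hA : TyOK Δ A A') : TyOK Δ (.bang A) (.bang A') :=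
  fun i hi l l' => hA i hi l l'

/-- Injectivity of codes gives semantic inversion of type formation. This lemma and the analogous
ones for `⊸` and `&` supply the well-formedness that the elimination and uniqueness rules do not
assume. -/
theorem TyOK.pi_dom {Δ A B} (h : TyOK Δ (.pi A B) (.pi A B)) : TyOK Δ A A :=
  fun i hi l l' => (Code.piOn_inj (h i hi l l')).1

theorem TyOK.instI {Δ A B B' a a'} (h : TyOK (A :: Δ) B B') (ha : TmOK Δ [] a a' A) :
    TyOK Δ (B.instI a) (B'.instI a') := fun i hi l l' => by
  rw [Ty.eval_instI, Ty.eval_instI, ha.eval_nil hi l l']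
  exact h _ (hi.scons (ha.right.mem_nil hi l')) l l'

theorem TyOK.pi_instI {Δ A B a} (h : TyOK Δ (.pi A B) (.pi A B)) (ha : TmOK Δ [] a a A) :
    TyOK Δ (B.instI a) (B.instI a) := fun i hi l l' => by
  rw [Ty.eval_instI, Ty.eval_instI, ha.eval_nil hi l l']
  refine (Code.piOn_inj (h i hi l l')).2 _ ?_
  rw [h.pi_dom i hi l nilEnv]
  exact ha.mem_nil hi l'

theorem TyOK.lolli_dom {Δ A B} (h : TyOK Δ (.lolli A B) (.lolli A B)) : TyOK Δ A A :=
  fun i hi l l' => (Code.lolli.inj (h i hi l l')).1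

theorem TyOK.lolli_cod {Δ A B} (h : TyOK Δ (.lolli A B) (.lolli A B)) : TyOK Δ B B :=
  fun i hi l l' => (Code.lolli.inj (h i hi l l')).2

theorem TyOK.and_left {Δ A B} (h : TyOK Δ (.and A B) (.and A B)) : TyOK Δ A A :=
  fun i hi l l' => (Code.and.inj (h i hi l l')).1

theorem TyOK.and_right {Δ A B} (h : TyOK Δ (.and A B) (.and A B)) : TyOK Δ B B :=
  fun i hi l l' => (Code.and.inj (h i hi l l')).2

theorem Ty.eval_subst_consI_consI (D : Ty) (a a' : Tm) (i l : Env) :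
    (D.subst ((Sub.id.consI a).consI a')).eval i l =
      D.eval (scons (a'.eval i l) (scons (a.eval i l) i)) l := by
  simp only [Ty.eval_subst, Sub.evalI_consI, Sub.evalL_consI, Sub.evalI_id, Sub.evalL_id]

theorem TyOK.subst_two {Δ A D a b a' b'} (h : TyOK (A.wk :: A :: Δ) D D) (ha : TmOK Δ [] a b A)
    (ha' : TmOK Δ [] a' b' A) : TyOK Δ (D.subst ((Sub.id.consI a).consI a'))
      (D.subst ((Sub.id.consI b).consI b')) := fun i hi l l' => by
  rw [Ty.eval_subst_consI_consI, Ty.eval_subst_consI_consI, ha.eval_nil hi l l',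
    ha'.eval_nil hi l l']
  refine h _ ((hi.scons (ha.right.mem_nil hi l')).scons ?_) l l'
  rw [Ty.eval_wk]
  exact ha'.right.mem_nil hi l'

theorem CtxOK.instI {Δ A Ξ a a'} (h : CtxOK (A :: Δ) Ξ) (ha : TmOK Δ [] a a' A) :
    CtxOK Δ (Ξ.map fun B => B.instI a) := by
  refine ⟨h.1.1, fun B hB => ?_⟩
  obtain ⟨B, hB', rfl⟩ := List.mem_map.1 hB
  exact (h.2 B hB').instI ha.left

/-! ### Term formers -/

theorem TmOK.spair {Δ Ξ A B a₁ a₂ b₁ b₂} (ha : TmOK Δ [] a₁ a₂ A)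
    (hb : TmOK Δ Ξ b₁ b₂ (B.instI a₁)) : TmOK Δ Ξ (.spair a₁ b₁) (.spair a₂ b₂) (.sig A B) :=
  fun i hi l l' hl => by
    obtain ⟨h₁, h₂⟩ := hb i hi l l' hl
    refine ⟨by simp only [Tm.eval, ha.eval_nil hi l l', h₁], ?_⟩
    rw [Ty.eval_instI, ← ha.left.eval_nil hi l nilEnv] at h₂
    exact pair_mem_depSum (ha.mem_nil hi l) h₂

theorem TmOK.slet {Δ Ξ Ξ' A B C t₁ t₂ c₁ c₂} (ht : TmOK Δ Ξ t₁ t₂ (.sig A B))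
    (hc : TmOK (A :: Δ) (B :: wkCtx Ξ') c₁ c₂ C.wk) :
    TmOK Δ (Ξ' ++ Ξ) (.slet (t₁.wkL Ξ'.length) c₁) (.slet (t₂.wkL Ξ'.length) c₂) C :=
  fun i hi l l' hl => by
    obtain ⟨hl', hl⟩ := satL_append.1 hl
    obtain ⟨h₁, h₂⟩ := ht i hi _ _ hl
    obtain ⟨h₃, h₄, -⟩ := depSum_elim h₂
    simp only [Tm.eval, Tm.eval_wkL, ← h₁]
    have := hc _ (hi.scons h₃) _ _ (SatL.scons (satL_wkCtx.2 hl') h₄)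
    rwa [Ty.eval_wk] at this

theorem TmOK.ilam {Δ Ξ A A' B b₁ b₂} (hA : TyOK Δ A A')
    (hb : TmOK (A :: Δ) (wkCtx Ξ) b₁ b₂ B) : TmOK Δ Ξ (.ilam A b₁) (.ilam A' b₂) (.pi A B) :=
  fun i hi l l' hl => by
    simp only [Tm.eval, Ty.eval, Code.El_piOn, ← hA i hi nilEnv l', hA.left i hi l nilEnv]
    exact ⟨lam_congr rfl fun x hx => (hb _ (hi.scons hx) _ _ (satL_wkCtx.2 hl)).1,
      lam_mem_depProd fun x hx => (hb _ (hi.scons hx) _ _ (satL_wkCtx.2 hl)).2⟩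

theorem TmOK.iapp {Δ Ξ A B f₁ f₂ a₁ a₂} (ha : TmOK Δ [] a₁ a₂ A)
    (hf : TmOK Δ Ξ f₁ f₂ (.pi A B)) : TmOK Δ Ξ (.iapp f₁ a₁) (.iapp f₂ a₂) (B.instI a₁) :=
  fun i hi l l' hl => by
    obtain ⟨h₁, h₂⟩ := hf i hi l l' hl
    simp only [Ty.eval, Code.El_piOn] at h₂
    simp only [Tm.eval, Ty.eval_instI, ← h₁, ← ha.eval_nil hi l l',
      ← ha.left.eval_nil hi l nilEnv, true_and]
    exact app_mem h₂ (ha.mem_nil hi l)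

theorem TmOK.refl {Δ A a₁ a₂} :
    TmOK Δ [] (.refl a₁) (.refl a₂) (.idt A a₁ a₁) :=
  fun _ _ _ _ _ => ⟨rfl, mem_idSet.2 ⟨rfl, rfl⟩⟩

/-- Having a value for `p₁` forces the endpoints to have equal values, so `D` at the pair of
endpoints is `D` on the diagonal, where `d₁` and `d₂` live. -/
theorem TmOK.idlet {Δ Ξ Ξ' A} {D : Ty} {d₁ d₂ a₁ a₂ a₁' a₂' p₁ p₂}
    (hd : TmOK (A :: Δ) Ξ d₁ d₂ (D.instI (.ivar 0))) (ha : TmOK Δ [] a₁ a₂ A)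
    (hp : TmOK Δ Ξ' p₁ p₂ (.idt A a₁ a₁')) :
    TmOK Δ (Ξ' ++ Ξ.map fun B => B.instI a₁) (.idlet a₁ a₁' p₁ (d₁.wkL Ξ'.length))
      (.idlet a₂ a₂' p₂ (d₂.wkL Ξ'.length)) (D.subst ((Sub.id.consI a₁).consI a₁')) :=
  fun i hi l l' hl => by
    obtain ⟨hl', hl⟩ := satL_append.1 hl
    obtain ⟨h₁, -⟩ := mem_idSet.1 (hp i hi _ _ hl').2
    rw [satL_map fun B _ => Ty.eval_instI B a₁ i nilEnv] at hl
    have := hd _ (hi.scons (ha.mem_nil hi nilEnv)) _ _ hl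
    rw [Ty.eval_instI] at this
    simp only [Tm.eval, Tm.eval_wkL, Ty.eval_subst_consI_consI, ← ha.eval_nil hi nilEnv l',
      ha.left.eval_nil hi l nilEnv, ← h₁]
    exact this

/-- An element of a singleton carries no information, so the value is that of the body alone. -/
theorem TmOK.letstar {Δ Ξ Ξ' t₁ t₂ a₁ a₂ A} (ha : TmOK Δ Ξ a₁ a₂ A) :
    TmOK Δ (Ξ' ++ Ξ) (.letstar t₁ (a₁.wkL Ξ'.length)) (.letstar t₂ (a₂.wkL Ξ'.length)) A :=
  fun i hi l l' hl => by
    simp only [Tm.eval, Tm.eval_wkL]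
    exact ha i hi _ _ (satL_append.1 hl).2

theorem TmOK.tpair {Δ Ξ Ξ' a₁ a₂ b₁ b₂ A B} (ha : TmOK Δ Ξ a₁ a₂ A) (hb : TmOK Δ Ξ' b₁ b₂ B) :
    TmOK Δ (Ξ' ++ Ξ) (.tpair (a₁.wkL Ξ'.length) b₁) (.tpair (a₂.wkL Ξ'.length) b₂)
      (.tensor A B) := fun i hi l l' hl => by
  obtain ⟨hl', hl⟩ := satL_append.1 hl
  obtain ⟨h₁, h₂⟩ := ha i hi _ _ hl
  obtain ⟨h₃, h₄⟩ := hb i hi _ _ hl'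
  simp only [Tm.eval, Tm.eval_wkL, ← h₁, ← h₃, true_and]
  exact pair_mem_depSum h₂ h₄

theorem TmOK.tlet {Δ Ξ Ξ' t₁ t₂ c₁ c₂ A B C} (ht : TmOK Δ Ξ t₁ t₂ (.tensor A B))
    (hc : TmOK Δ (B :: A :: Ξ') c₁ c₂ C) :
    TmOK Δ (Ξ' ++ Ξ) (.tlet (t₁.wkL Ξ'.length) c₁) (.tlet (t₂.wkL Ξ'.length) c₂) C :=
  fun i hi l l' hl => by
    obtain ⟨hl', hl⟩ := satL_append.1 hl
    obtain ⟨h₁, h₂⟩ := ht i hi _ _ hl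
    obtain ⟨h₃, h₄, -⟩ := depSum_elim h₂
    simp only [Tm.eval, Tm.eval_wkL, ← h₁]
    exact hc i hi _ _ ((hl'.scons h₃).scons h₄)

theorem TmOK.llam {Δ Ξ A A' B b₁ b₂} (hA : TyOK Δ A A') (hb : TmOK Δ (A :: Ξ) b₁ b₂ B) :
    TmOK Δ Ξ (.llam A b₁) (.llam A' b₂) (.lolli A B) := fun i hi l l' hl => by
  simp only [Tm.eval, Ty.eval, Code.El, ← hA i hi nilEnv l', hA.left i hi l nilEnv]
  exact ⟨lam_congr rfl fun x hx => (hb i hi _ _ (hl.scons hx)).1,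
    lam_mem_depProd fun x hx => (hb i hi _ _ (hl.scons hx)).2⟩

theorem TmOK.lapp {Δ Ξ Ξ' f₁ f₂ a₁ a₂ A B} (hf : TmOK Δ Ξ f₁ f₂ (.lolli A B))
    (ha : TmOK Δ Ξ' a₁ a₂ A) :
    TmOK Δ (Ξ' ++ Ξ) (.lapp (f₁.wkL Ξ'.length) a₁) (.lapp (f₂.wkL Ξ'.length) a₂) B :=
  fun i hi l l' hl => by
    obtain ⟨hl', hl⟩ := satL_append.1 hl
    obtain ⟨h₁, h₂⟩ := hf i hi _ _ hl
    obtain ⟨h₃, h₄⟩ := ha i hi _ _ hl'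
    simp only [Tm.eval, Tm.eval_wkL, ← h₁, ← h₃, true_and]
    exact app_mem h₂ h₄

theorem TmOK.pair {Δ Ξ a₁ a₂ b₁ b₂ A B} (ha : TmOK Δ Ξ a₁ a₂ A) (hb : TmOK Δ Ξ b₁ b₂ B) :
    TmOK Δ Ξ (.pair a₁ b₁) (.pair a₂ b₂) (.and A B) := fun i hi l l' hl => by
  obtain ⟨h₁, h₂⟩ := ha i hi _ _ hl
  obtain ⟨h₃, h₄⟩ := hb i hi _ _ hl
  simp only [Tm.eval, ← h₁, ← h₃, true_and]
  exact pair_mem_depSum h₂ h₄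

theorem TmOK.fst {Δ Ξ t₁ t₂ A B} (ht : TmOK Δ Ξ t₁ t₂ (.and A B)) :
    TmOK Δ Ξ (.fst t₁) (.fst t₂) A := fun i hi _ _ hl =>
  have h := ht i hi _ _ hl
  ⟨congrArg pfst h.1, (depSum_elim h.2).1⟩

theorem TmOK.snd {Δ Ξ t₁ t₂ A B} (ht : TmOK Δ Ξ t₁ t₂ (.and A B)) :
    TmOK Δ Ξ (.snd t₁) (.snd t₂) B := fun i hi _ _ hl =>
  have h := ht i hi _ _ hl
  ⟨congrArg psnd h.1, (depSum_elim h.2).2.1⟩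

theorem TmOK.false {Δ Ξ t₁ t₂} (ht : TmOK Δ Ξ t₁ t₂ .zero) {i l l'} (hi : SatI Δ i)
    (hl : SatL i Ξ l l') : False := ZFSet.notMem_empty _ (ht i hi l l' hl).2

theorem TmOK.abort {Δ Ξ Ξ' t₁ t₂ B} (ht : TmOK Δ Ξ t₁ t₂ .zero) :
    TmOK Δ (Ξ' ++ Ξ) (.abort (t₁.wkL Ξ'.length)) (.abort (t₂.wkL Ξ'.length)) B :=
  fun _ hi _ _ hl => (ht.false hi (satL_append.1 hl).2).elim

theorem TmOK.inl {Δ Ξ a₁ a₂ A B} (ha : TmOK Δ Ξ a₁ a₂ A) :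
    TmOK Δ Ξ (.inl a₁) (.inl a₂) (.plus A B) := fun i hi _ _ hl =>
  have h := ha i hi _ _ hl
  ⟨congrArg injl h.1, mem_disjSum.2 (.inl ⟨_, h.2, rfl⟩)⟩

theorem TmOK.inr {Δ Ξ b₁ b₂ A B} (hb : TmOK Δ Ξ b₁ b₂ B) :
    TmOK Δ Ξ (.inr b₁) (.inr b₂) (.plus A B) := fun i hi _ _ hl =>
  have h := hb i hi _ _ hl
  ⟨congrArg injr h.1, mem_disjSum.2 (.inr ⟨_, h.2, rfl⟩)⟩

theorem Tm.eval_ren_shift_upL (a : Tm) (k : ℕ) (i l : Env) (x : ZFSet) :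
    (a.ren (Ren.shift 0 k).upL).eval i (scons x l) = a.eval i (scons x (drop k l)) := by
  rw [Tm.eval_ren, Ren.upL, scons_comp_liftIdx]
  rfl

theorem TmOK.case {Δ Ξ Ξ' t₁ t₂ c₁ c₂ d₁ d₂ A B C} (hc : TmOK Δ (A :: Ξ) c₁ c₂ C)
    (hd : TmOK Δ (B :: Ξ) d₁ d₂ C) (ht : TmOK Δ Ξ' t₁ t₂ (.plus A B)) :
    TmOK Δ (Ξ' ++ Ξ)
      (.case t₁ (c₁.ren (Ren.shift 0 Ξ'.length).upL) (d₁.ren (Ren.shift 0 Ξ'.length).upL))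
      (.case t₂ (c₂.ren (Ren.shift 0 Ξ'.length).upL) (d₂.ren (Ren.shift 0 Ξ'.length).upL)) C :=
  fun i hi l l' hl => by
    obtain ⟨hl', hl⟩ := satL_append.1 hl
    obtain ⟨h₁, h₂⟩ := ht i hi _ _ hl'
    simp only [Tm.eval, Tm.eval_ren_shift_upL, ← h₁]
    rcases mem_disjSum.1 h₂ with ⟨x, hx, h⟩ | ⟨x, hx, h⟩
    · simp only [← h, caseOf_injl]
      exact hc i hi _ _ (hl.scons hx)
    · simp only [← h, caseOf_injr]
      exact hd i hi _ _ (hl.scons hx)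

theorem TmOK.bang {Δ a₁ a₂ A} (h : TmOK Δ [] a₁ a₂ A) : TmOK Δ [] (.bang a₁) (.bang a₂) (.bang A) :=
  h

theorem TmOK.letbang {Δ Ξ Ξ' t₁ t₂ b₁ b₂ A B} (ht : TmOK Δ Ξ t₁ t₂ (.bang A))
    (hb : TmOK (A :: Δ) (wkCtx Ξ') b₁ b₂ B.wk) :
    TmOK Δ (Ξ' ++ Ξ) (.letbang (t₁.wkL Ξ'.length) b₁) (.letbang (t₂.wkL Ξ'.length) b₂) B :=
  fun i hi l l' hl => by
    obtain ⟨hl', hl⟩ := satL_append.1 hl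
    obtain ⟨h₁, h₂⟩ := ht i hi _ _ hl
    simp only [Tm.eval, Tm.eval_wkL, ← h₁]
    have := hb _ (hi.scons h₂) _ _ (satL_wkCtx.2 hl')
    rwa [Ty.eval_wk] at this

/-! ### Computation and uniqueness rules -/

/-- Nothing is assumed about `a` or `A` separately. If the value of `a` were outside the domain, the
redex would have value `∅`, which no type contains. The linear version is proved in the same way. -/
theorem TmOK.ilam_beta {Δ Ξ A a b C} (h : TmOK Δ Ξ (.iapp (.ilam A b) a) (.iapp (.ilam A b) a) C) :
    TmOK Δ Ξ (.iapp (.ilam A b) a) (b.instI a) C := h.of_eval_eq fun i hi l hl => by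
  have h' := (h i hi l l hl).2
  rw [Tm.eval_instI]
  simp only [Tm.eval] at h' ⊢
  by_cases ha : a.eval i l ∈ (A.eval i l).El
  · exact app_lam ha
  · rw [app_lam_of_notMem ha] at h'
    exact (Ty.empty_notMem _ _ _ h').elim

theorem TmOK.llam_beta {Δ Ξ A a b C} (h : TmOK Δ Ξ (.lapp (.llam A b) a) (.lapp (.llam A b) a) C) :
    TmOK Δ Ξ (.lapp (.llam A b) a) (b.instL a) C := h.of_eval_eq fun i hi l hl => by
  have h' := (h i hi l l hl).2
  rw [Tm.eval_instL]
  simp only [Tm.eval] at h' ⊢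
  by_cases ha : a.eval i l ∈ (A.eval i l).El
  · exact app_lam ha
  · rw [app_lam_of_notMem ha] at h'
    exact (Ty.empty_notMem _ _ _ h').elim

theorem TmOK.slet_eta {Δ Ξ A B t} (h : TmOK Δ Ξ t t (.sig A B)) :
    TmOK Δ Ξ (.slet t (.spair (.ivar 0) (.lvar 0))) t (.sig A B) :=
  TmOK.symm <| h.of_eval_eq fun i hi l hl => (depSum_elim (h i hi l l hl).2).2.2.symm

theorem TmOK.tlet_eta {Δ Ξ A B t} (h : TmOK Δ Ξ t t (.tensor A B)) :
    TmOK Δ Ξ (.tlet t (.tpair (.lvar 1) (.lvar 0))) t (.tensor A B) :=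
  TmOK.symm <| h.of_eval_eq fun i hi l hl => (depSum_elim (h i hi l l hl).2).2.2.symm

theorem TmOK.pair_eta {Δ Ξ A B t} (h : TmOK Δ Ξ t t (.and A B)) :
    TmOK Δ Ξ (.pair (.fst t) (.snd t)) t (.and A B) :=
  TmOK.symm <| h.of_eval_eq fun i hi l hl => (depSum_elim (h i hi l l hl).2).2.2.symm

theorem TmOK.ilam_eta {Δ Ξ A B f} (hA : TyOK Δ A A) (h : TmOK Δ Ξ f f (.pi A B)) :
    TmOK Δ Ξ f (.ilam A (.iapp f.wk (.ivar 0))) (.pi A B) := h.of_eval_eq fun i hi l hl => by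
  have h' := (h i hi l l hl).2
  simp only [Ty.eval, Code.El_piOn] at h'
  simp only [Tm.eval, Tm.eval_wk, drop_one_scons, scons_zero]
  rw [hA i hi l nilEnv]
  exact (lam_app h').symm

theorem TmOK.llam_eta {Δ Ξ A B f} (hA : TyOK Δ A A) (h : TmOK Δ Ξ f f (.lolli A B)) :
    TmOK Δ Ξ (.llam A (.lapp (f.wkL 1) (.lvar 0))) f (.lolli A B) :=
  TmOK.symm <| h.of_eval_eq fun i hi l hl => by
    have h' := (h i hi l l hl).2
    simp only [Tm.eval, Tm.eval_wkL, drop_one_scons, scons_zero]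
    rw [hA i hi l nilEnv]
    exact (lam_app h').symm

theorem TmOK.case_eta {Δ Ξ A B t} (h : TmOK Δ Ξ t t (.plus A B)) :
    TmOK Δ Ξ (.case t (.inl (.lvar 0)) (.inr (.lvar 0))) t (.plus A B) :=
  TmOK.symm <| h.of_eval_eq fun i hi l hl => by
    rcases mem_disjSum.1 (h i hi l l hl).2 with ⟨x, _, h⟩ | ⟨x, _, h⟩
    · simp only [Tm.eval, ← h, caseOf_injl, scons_zero]
    · simp only [Tm.eval, ← h, caseOf_injr, scons_zero]

theorem TmOK.top_eta {Δ Ξ t} (h : TmOK Δ Ξ t t .top) : TmOK Δ Ξ t .nil .top :=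
  h.of_eval_eq fun i hi l hl => ZFSet.mem_singleton.1 (h i hi l l hl).2

theorem TmOK.unit_eta {Δ Ξ t} (h : TmOK Δ Ξ t t .unit) : TmOK Δ Ξ (.letstar t .star) t .unit :=
  TmOK.symm <| h.of_eval_eq fun i hi l hl => ZFSet.mem_singleton.1 (h i hi l l hl).2

/-- A satisfying environment gives `x` and `x'` the same value and `z` the value `pt`, so replacing
them by `w`, `w` and `refl` does not change the environment in which `c` is evaluated. -/
theorem TmOK.idlet_eta {Δ Ξ A c C} (h : TmOK (A.wk :: A :: Δ)
      (.idt A.wk.wk (.ivar 1) (.ivar 0) :: Ξ) c c C) :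
    TmOK (A.wk :: A :: Δ) (.idt A.wk.wk (.ivar 1) (.ivar 0) :: Ξ)
      (.idlet (.ivar 1) (.ivar 0) (.lvar 0)
        (c.subst ⟨fun | 0 => .ivar 0 | n + 1 => .ivar (if n = 0 then 0 else n + 2),
          fun | 0 => .refl (.ivar 0) | n + 1 => .lvar (n + 1)⟩)) c C :=
  TmOK.symm <| h.of_eval_eq fun i hi l hl => by
    obtain ⟨h₁, h₂⟩ := mem_idSet.1 hl.2.1
    simp only [Tm.eval] at h₁
    rw [Tm.eval, Tm.eval_subst]
    congr 1
    · funext n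
      -- The variable `w` receives the value of `x`, index `1`; hence only index `0`, which is `x'`,
      -- requires the equality of endpoints.
      rcases n with _ | _ | n
      · exact h₁.symm
      · rfl
      · rfl
    · funext n
      rcases n with _ | n
      · exact h₂
      · rfl

/-! ### Soundness -/

/-- Formation, introduction, elimination and congruence rules use the lemma of their former, applied
to a pair of terms that is diagonal except for congruence. Computation, uniqueness and commuting
rules mostly reduce by `TmOK.of_eval_eq` to equality of values with one side already valid. -/
theorem Derivable.valid {J : Judgement} (h : Derivable J) : J.Valid := by
  induction h with
  | cEmp => exact WfI.ctxOK_nil trivial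
  | intCExt _ _ h₁ h₂ => exact CtxOK.wk h₁ h₂.2
  | intCExtEq _ _ h₁ h₂ => exact valid_intCExtEq h₁ h₂.2
  | linCExt _ _ h₁ h₂ => exact CtxOK.cons h₁ h₂.2
  | linCExtEq _ _ h₁ h₂ =>
    exact ⟨h₁.1.cons h₂.2.left, h₁.2.1.cons (h₂.2.symm.left.conv h₁.2.2.1), h₁.2.2.1,
      .cons h₂.2 h₁.2.2.2⟩
  | intVar Δ' _ h => exact valid_intVar Δ' h
  | linVar _ h => exact ⟨h, h.head, fun i hi l l' hl => ⟨hl.1, hl.2.1⟩⟩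
  | cEqR _ h => exact ⟨h, h, fun _ => Iff.rfl, List.forall₂_same.2 h.2⟩
  | cEqS _ h => exact valid_ctxEq_symm h
  | cEqT _ _ h₁ h₂ => exact valid_ctxEq_trans h₁ h₂
  | tyEqR _ h => exact h
  | tyEqS _ h => exact ⟨h.1, h.2.symm⟩
  | tyEqT _ _ h₁ h₂ => exact ⟨h₁.1, h₁.2.trans h₂.2⟩
  | tmEqR _ h => exact h
  | tmEqS _ h => exact ⟨h.1, h.2.1, h.2.2.symm⟩
  | tmEqT _ _ h₁ h₂ => exact ⟨h₁.1, h₁.2.1, h₁.2.2.trans h₂.2.2⟩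
  | tmConv _ _ _ h₁ h₂ h₃ =>
    exact ⟨h₂.2.1, h₃.2.symm.left.conv h₂.2.2.1, h₁.2.2.conv h₂ h₃.2⟩
  | tmEqConv _ _ _ h₁ h₂ h₃ =>
    exact ⟨h₂.2.1, h₃.2.symm.left.conv h₂.2.2.1, h₁.2.2.conv h₂ h₃.2⟩
  | tyConv _ _ h₁ h₂ => exact ⟨h₂.2.1, h₁.2.conv h₂.2.2.1⟩
  | tyEqConv _ _ h₁ h₂ => exact ⟨h₂.2.1, h₁.2.conv h₂.2.2.1⟩
  | @intWeak Δ Ξ A J Δ' _ _ h₁ h₂ =>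
    exact Judgement.Valid.renTele (Δ₂ := A :: Δ) (fun n => rfl) ⟨h₂.1.1, h₂.2⟩ (fun i hi => hi.1) Δ' h₁
  | @intExch Δ Ξ A A' J Δ' _ _ h₁ h₂ =>
    -- The rule has no premise that `A` is a type over `Δ`; this is recovered from validity of the
    -- original context.
    have hA : WfI (A'.wk :: A :: Δ) := h₁.1.1.of_append
    refine Judgement.Valid.renTele (Δ₂ := A.wk :: A' :: Δ) (fun n => rfl)
      ⟨⟨h₂.1.1, h₂.2⟩, hA.1.2.wk⟩ (fun i hi => ?_) Δ' h₁
    obtain ⟨⟨hi₁, hi₂⟩, hi₃⟩ := hi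
    rw [Ty.eval_wk] at hi₃
    refine ⟨⟨hi₁, hi₃⟩, ?_⟩
    rw [Ty.eval_wk]
    exact hi₂
  | linExch Ξ' _ h => exact h.linExch Ξ'
  | intSubst Δ' _ _ h₁ h₂ => exact h₁.substTele Δ' h₂
  | linTmSubst _ _ h₁ h₂ => exact ⟨h₁.1.tail.append h₂.1, h₁.2.1, h₁.2.2.cutL h₂.2.2⟩
  | linTmSubstEq _ _ h₁ h₂ => exact ⟨h₁.1.tail.append h₂.1, h₁.2.1, h₁.2.2.cutL h₂.2.2⟩
  | sigF _ h => exact ⟨h.1.1.1.ctxOK_nil, h.1.1.2.sig h.2⟩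
  | sigI _ _ _ h₁ h₂ h₃ => exact ⟨h₃.1, h₂.2.1.sig h₁.2, h₂.2.2.spair h₃.2.2⟩
  | sigE _ _ _ _ h₁ h₂ h₃ h₄ => exact ⟨h₃.1.append h₁, h₂.2, h₃.2.2.slet h₄.2.2⟩
  | sigC _ h =>
    refine ⟨h.1, h.2.1, h.2.2.of_eval_eq fun i hi l hl => ?_⟩
    simp only [Tm.eval, Tm.eval_subst, Sub.evalI_consI, Sub.evalL_consI, Sub.evalI_consL,
      Sub.evalL_consL, Sub.evalI_id, Sub.evalL_id, pfst_pair, psnd_pair]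
  | sigU _ _ _ h => exact ⟨h.1, h.2.1, h.2.2.slet_eta⟩
  | piF _ h => exact ⟨h.1.1.1.ctxOK_nil, h.1.1.2.pi h.2⟩
  | piI _ _ h₁ h₂ => exact ⟨h₁, h₂.1.1.2.pi h₂.2.1, h₂.2.2.ilam h₂.1.1.2⟩
  | piE _ _ h₁ h₂ => exact ⟨h₂.1, h₂.2.1.pi_instI h₁.2.2, h₁.2.2.iapp h₂.2.2⟩
  | piC _ h => exact ⟨h.1, h.2.1, h.2.2.ilam_beta⟩
  | piU _ _ _ h => exact ⟨h.1, h.2.1, h.2.2.ilam_eta h.2.1.pi_dom⟩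
  | idF _ _ h₁ h₂ => exact ⟨h₁.1, .idt h₁.2.2 h₂.2.2⟩
  | idI _ h => exact ⟨h.1, .idt h.2.2 h.2.2, TmOK.refl⟩
  | idE _ _ _ _ _ h₁ h₂ h₃ h₄ h₅ =>
    exact ⟨(h₂.1.instI h₃.2.2).append h₅.1, h₁.2.subst_two h₃.2.2 h₄.2.2,
      h₂.2.2.idlet h₃.2.2 h₅.2.2⟩
  | idC _ h =>
    refine ⟨h.1, h.2.1, h.2.2.of_eval_eq fun i hi l hl => ?_⟩
    rw [Tm.eval, Tm.eval_instI]
  | idU hd _ _ _ h =>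
    subst hd
    exact ⟨h.1, h.2.1, h.2.2.idlet_eta⟩
  | unitF _ h => exact ⟨h, fun _ _ _ _ => rfl⟩
  | unitI _ h =>
    exact ⟨h, fun _ _ _ _ => rfl, fun _ _ _ _ _ => ⟨rfl, ZFSet.mem_singleton.2 rfl⟩⟩
  | unitE _ _ h₁ h₂ => exact ⟨h₂.1.append h₁.1, h₂.2.1, h₂.2.2.letstar⟩
  | unitC _ h => exact ⟨h.1, h.2.1, h.2.2.of_eval_eq fun _ _ _ _ => rfl⟩
  | unitU _ _ _ h => exact ⟨h.1, h.2.1, h.2.2.unit_eta⟩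
  | tensorF _ _ h₁ h₂ => exact ⟨h₁.1, h₁.2.tensor h₂.2⟩
  | tensorI _ _ h₁ h₂ => exact ⟨h₁.1.append h₂.1, h₁.2.1.tensor h₂.2.1, h₁.2.2.tpair h₂.2.2⟩
  | tensorE _ _ h₁ h₂ => exact ⟨h₁.1.append h₂.1.tail.tail, h₂.2.1, h₁.2.2.tlet h₂.2.2⟩
  | tensorC _ h =>
    refine ⟨h.1, h.2.1, h.2.2.of_eval_eq fun i hi l hl => ?_⟩
    simp only [Tm.eval, Tm.eval_subst, Sub.evalI_consL, Sub.evalL_consL, Sub.evalI_id,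
      Sub.evalL_id, pfst_pair, psnd_pair]
  | tensorU _ _ _ h => exact ⟨h.1, h.2.1, h.2.2.tlet_eta⟩
  | lolliF _ _ h₁ h₂ => exact ⟨h₁.1, h₁.2.lolli h₂.2⟩
  | lolliI _ h => exact ⟨h.1.tail, h.1.head.lolli h.2.1, h.2.2.llam h.1.head⟩
  | lolliE _ _ h₁ h₂ => exact ⟨h₁.1.append h₂.1, h₁.2.1.lolli_cod, h₁.2.2.lapp h₂.2.2⟩
  | lolliC _ h => exact ⟨h.1, h.2.1, h.2.2.llam_beta⟩
  | lolliU _ _ _ h => exact ⟨h.1, h.2.1, h.2.2.llam_eta h.2.1.lolli_dom⟩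
  | topF _ h => exact ⟨h, fun _ _ _ _ => rfl⟩
  | topI _ h =>
    exact ⟨h, fun _ _ _ _ => rfl, fun _ _ _ _ _ => ⟨rfl, ZFSet.mem_singleton.2 rfl⟩⟩
  | topU _ h => exact ⟨h.1, h.2.1, h.2.2.top_eta⟩
  | andF _ _ h₁ h₂ => exact ⟨h₁.1, h₁.2.and h₂.2⟩
  | andI _ _ h₁ h₂ => exact ⟨h₁.1, h₁.2.1.and h₂.2.1, h₁.2.2.pair h₂.2.2⟩
  | andE1 _ h => exact ⟨h.1, h.2.1.and_left, h.2.2.fst⟩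
  | andE2 _ h => exact ⟨h.1, h.2.1.and_right, h.2.2.snd⟩
  | andC1 _ h => exact ⟨h.1, h.2.1, h.2.2.of_eval_eq fun _ _ _ _ => pfst_pair _ _⟩
  | andC2 _ h => exact ⟨h.1, h.2.1, h.2.2.of_eval_eq fun _ _ _ _ => psnd_pair _ _⟩
  | andU _ _ _ h => exact ⟨h.1, h.2.1, h.2.2.pair_eta⟩
  | zeroF _ h => exact ⟨h, fun _ _ _ _ => rfl⟩
  | zeroE _ _ _ h₁ h₂ h₃ => exact ⟨h₃.1.append h₁, h₂.2, h₃.2.2.abort⟩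
  | zeroU _ h => exact ⟨h.1, h.2.1, fun _ hi _ _ hl => (h.2.2.false hi hl).elim⟩
  | plusF _ _ h₁ h₂ => exact ⟨h₁.1, h₁.2.plus h₂.2⟩
  | plusI1 _ _ h₁ h₂ => exact ⟨h₂.1, h₂.2.1.plus h₁.2, h₂.2.2.inl⟩
  | plusI2 _ _ h₁ h₂ => exact ⟨h₂.1, h₁.2.plus h₂.2.1, h₂.2.2.inr⟩
  | plusE _ _ _ h₁ h₂ h₃ => exact ⟨h₁.1.tail.append h₃.1, h₁.2.1, h₁.2.2.case h₂.2.2 h₃.2.2⟩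
  | plusC1 _ h =>
    refine ⟨h.1, h.2.1, h.2.2.of_eval_eq fun i hi l hl => ?_⟩
    rw [Tm.eval, Tm.eval, caseOf_injl, Tm.eval_instL]
  | plusC2 _ h =>
    refine ⟨h.1, h.2.1, h.2.2.of_eval_eq fun i hi l hl => ?_⟩
    rw [Tm.eval, Tm.eval, caseOf_injr, Tm.eval_instL]
  | plusU _ _ _ h => exact ⟨h.1, h.2.1, h.2.2.case_eta⟩
  | bangF _ h => exact ⟨h.1, h.2.bang⟩
  | bangI _ h => exact ⟨h.1, h.2.1.bang, h.2.2.bang⟩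
  | bangE _ _ _ _ h₁ h₂ h₃ h₄ => exact ⟨h₃.1.append h₁, h₂.2, h₃.2.2.letbang h₄.2.2⟩
  | bangC _ h =>
    refine ⟨h.1, h.2.1, h.2.2.of_eval_eq fun i hi l hl => ?_⟩
    rw [Tm.eval, Tm.eval, Tm.eval_instI]
  | bangU _ _ _ h => exact ⟨h.1, h.2.1, (h.2.2.of_eval_eq fun _ _ _ _ => rfl).symm⟩
  | commLet C L hL _ _ h _ =>
    exact ⟨h.1, h.2.1, h.2.2.of_eval_eq fun i hi l hl => eval_commLet C hL _ i l⟩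
  | commAbort C ht _ _ h₁ h₂ =>
    -- No environment satisfies the context, since it would yield an element of `0`; the equation
    -- holds vacuously.
    exact ⟨h₂.1, h₂.2.1, fun _ hi _ _ hl => (h₁.2.2.false hi (satL_append.1 hl).2).elim⟩
  | commCase C _ _ _ h₁ h₂ _ =>
    exact ⟨h₂.1, h₂.2.1, h₂.2.2.of_eval_eq fun i hi l hl =>
      eval_commCase C (h₁.2.2 i hi l l (satL_append.1 hl).1).2⟩
  | sigCong _ _ h₁ h₂ => exact ⟨h₁.1, h₁.2.sig h₂.2⟩
  | piCong _ _ h₁ h₂ => exact ⟨h₁.1, h₁.2.pi h₂.2⟩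
  | idCong _ _ _ h₁ h₂ h₃ => exact ⟨h₁.1, .idt h₂.2.2 h₃.2.2⟩
  | tensorCong _ _ h₁ h₂ => exact ⟨h₁.1, h₁.2.tensor h₂.2⟩
  | lolliCong _ _ h₁ h₂ => exact ⟨h₁.1, h₁.2.lolli h₂.2⟩
  | andCong _ _ h₁ h₂ => exact ⟨h₁.1, h₁.2.and h₂.2⟩
  | plusCong _ _ h₁ h₂ => exact ⟨h₁.1, h₁.2.plus h₂.2⟩
  | bangCong _ h => exact ⟨h.1, h.2.bang⟩
  | spairCong _ _ _ h₁ h₂ h₃ => exact ⟨h₃.1, h₂.2.1.sig h₁.2, h₂.2.2.spair h₃.2.2⟩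
  | sletCong _ _ _ _ h₁ h₂ h₃ h₄ => exact ⟨h₃.1.append h₁, h₂.2, h₃.2.2.slet h₄.2.2⟩
  | ilamCong _ _ _ h₁ h₂ h₃ => exact ⟨h₁, h₂.2.left.pi h₃.2.1, h₃.2.2.ilam h₂.2⟩
  | iappCong _ _ h₁ h₂ => exact ⟨h₂.1, h₂.2.1.pi_instI h₁.2.2.left, h₁.2.2.iapp h₂.2.2⟩
  | reflCong _ h => exact ⟨h.1, .idt h.2.2.left h.2.2.left, TmOK.refl⟩
  | idletCong _ _ _ _ _ h₁ h₂ h₃ h₄ h₅ =>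
    exact ⟨(h₂.1.instI h₃.2.2).append h₅.1, h₁.2.subst_two h₃.2.2.left h₄.2.2.left,
      h₂.2.2.idlet h₃.2.2 h₅.2.2⟩
  | letstarCong _ _ h₁ h₂ => exact ⟨h₂.1.append h₁.1, h₂.2.1, h₂.2.2.letstar⟩
  | tpairCong _ _ h₁ h₂ => exact ⟨h₁.1.append h₂.1, h₁.2.1.tensor h₂.2.1, h₁.2.2.tpair h₂.2.2⟩
  | tletCong _ _ h₁ h₂ => exact ⟨h₁.1.append h₂.1.tail.tail, h₂.2.1, h₁.2.2.tlet h₂.2.2⟩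
  | llamCong _ _ h₁ h₂ => exact ⟨h₂.1.tail, h₁.2.left.lolli h₂.2.1, h₂.2.2.llam h₁.2⟩
  | lappCong _ _ h₁ h₂ => exact ⟨h₁.1.append h₂.1, h₁.2.1.lolli_cod, h₁.2.2.lapp h₂.2.2⟩
  | pairCong _ _ h₁ h₂ => exact ⟨h₁.1, h₁.2.1.and h₂.2.1, h₁.2.2.pair h₂.2.2⟩
  | fstCong _ h => exact ⟨h.1, h.2.1.and_left, h.2.2.fst⟩
  | sndCong _ h => exact ⟨h.1, h.2.1.and_right, h.2.2.snd⟩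
  | abortCong _ _ _ h₁ h₂ h₃ => exact ⟨h₃.1.append h₁, h₂.2, h₃.2.2.abort⟩
  | inlCong _ _ h₁ h₂ => exact ⟨h₂.1, h₂.2.1.plus h₁.2, h₂.2.2.inl⟩
  | inrCong _ _ h₁ h₂ => exact ⟨h₂.1, h₁.2.plus h₂.2.1, h₂.2.2.inr⟩
  | caseCong _ _ _ h₁ h₂ h₃ =>
    exact ⟨h₁.1.tail.append h₃.1, h₁.2.1, h₁.2.2.case h₂.2.2 h₃.2.2⟩
  | bangTmCong _ h => exact ⟨h.1, h.2.1.bang, h.2.2.bang⟩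
  | letbangCong _ _ _ _ h₁ h₂ h₃ h₄ => exact ⟨h₃.1.append h₁, h₂.2, h₃.2.2.letbang h₄.2.2⟩

-- Consistency from soundness

theorem consistentAsTypeTheory : ConsistentAsTypeTheory := fun h => by
  have hu : Derivable (.ent [] [] (.ty .unit)) := .unitF .cEmp
  have hs : Derivable (.ent [] [] (.tm .star .unit)) := .unitI .cEmp
  -- The separating terms are `inl(*)` and `inr(*)` of type `I ⊕ I`: their values carry the
  -- different tags `∅` and `{∅}`.
  have h' := ((h [] [] (.plus .unit .unit) _ _ (.plusI1 hu hs) (.plusI2 hu hs)).valid.2.2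
    nilEnv trivial nilEnv nilEnv trivial).1
  exact singleton_empty_ne (ZFSet.pair_inj.1 h').1.symm

theorem consistentAsLogic : ConsistentAsLogic := fun h => by
  obtain ⟨a, ha⟩ := h .zero (.zeroF .cEmp)
  exact ha.valid.2.2.false (i := nilEnv) (l := nilEnv) (l' := nilEnv) trivial trivial

end ILDTT

theorem mainTheorem9 : ILDTT.ConsistentAsTypeTheory ∧ ILDTT.ConsistentAsLogic :=
  ⟨ILDTT.consistentAsTypeTheory, ILDTT.consistentAsLogic⟩
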